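/- Let $G$ be a directed graph (loops and multiple edges allowed) whose in-degrees and out-degrees are bounded by a common constant, and let $N$ be its maximal out-degree. Let the edges starting at each vertex $v$ be labelled bijectively by $1,\dots,\deg_{out}(v)$. The shadowed graph $\widehat G$ has the vertices of $G$ and, as edges, the edges $e$ of $G$ together with reversed copies $e^{-1}$ (with $(e^{-1})^{-1}=e$); if $e\in E(G)$ has label $k$, then $e^{-1}$ has label $-k$. Let $\mathbb G$ be the graph groupoid (the free groupoid on $G$: vertices and reduced paths in $\widehat G$, with the undefined products equal to an empty element $\emptyset$). On the Hilbert space $H_G$ with orthonormal basis $(\xi_g)_{g\in\mathbb G\setminus\{\emptyset\}}$ let $R_w\xi_g=\xi_{gw}$ (with $\xi_\emptyset=0$ and $R_\emptyset=0$), so that $R_{w_1}R_{w_2}=R_{w_2w_1}$. Let $M_G$ be the von Neumann algebra generated by all $R_w$, let $D_G\subseteq M_G$ be the von Neumann algebra generated by the $R_v$, $v\in V(G)$, and let $E:M_G\to D_G$, $E(\sum_w m_wR_w)=\sum_{v\in V(G)}m_vR_v$, be the canonical conditional expectation. For $k=\pm1,\dots,\pm N$ let $T_k=\sum_{e\in E(\widehat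 G),\ \mathrm{label}(e)=k}R_e$ (strong operator sum), and let $T_G=\sum_{k=-N}^{-1}T_k+\sum_{k=1}^{N}T_k\in M_G$ be the labeling operator. For $a_1,\dots,a_n\in M_G$ let $$k_n(a_1,\dots,a_n)=\sum_{\pi\in NC(n)}\mu(\pi,1_n)\,E_\pi(a_1,\dots,a_n)$$ be the $D_G$-valued free cumulant, where $NC(n)$ is the lattice of noncrossing partitions of $\{1,\dots,n\}$ with maximal element $1_n$, $\mu$ is its Moebius function, and $E_\pi$ is the nested partition-dependent moment (for instance $E_\pi(a_1,\dots,a_5)=E(a_1E(a_2a_3)a_4)E(a_5)$ for $\pi=\{(1,4),(2,3),(5)\}$). For $n\ge 1$ and $(i_1,\dots,i_n)\in\{\pm1,\dots,\pm N\}^n$ let $\mathcal W_n^{(c)}(i_1,\dots,i_n)$ be the set of words $w=e_1\cdots e_n$ in $E(\widehat G)$ that are paths in $\widehat G$, whose letters have the labels $i_1,\dots,i_n$, with $i_1+\dots+i_n=0$, and for which there is a single $e\in E(\widehat G)$ such that all $e_j\in\{e,e^{-1}\}$. Let $\mathcal W_n^{(c)}$ be the union of these sets over all $(i_1,\dots,i_n)\in\{\pm1,\dots,\pm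 N\}^n$. For $e_1,\dots,e_n\in E(\widehat G)$ and the word $w=e_n\cdots e_1$ let $$\mu_w=\mu_{(e_1,\dots,e_n)}=\sum_{\pi}\mu(\pi,1_n),$$ the sum over all $\pi\in NC(n)$ with $E_\pi(R_{e_1},\dots,R_{e_n})=E(R_{e_n\cdots e_1})\ne 0$. For a word $w$, $R_w$ is the operator of the element of $\mathbb G$ obtained by reducing $w$. Then, for every $n\ge1$: if $n$ is odd, $k_n(T_G,\dots,T_G)=0$; and if $n$ is even, $$k_n(T_G,\dots,T_G)=\sum_{w\in\mathcal W_n^{(c)}}\mu_w\,R_w ,$$ where the (possibly infinite) sum converges unconditionally in the strong operator topology, that is, $\sum_{w}\mu_wR_w\xi$ converges unconditionally to $k_n(T_G,\dots,T_G)\xi$ for every $\xi\in H_G$. -/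

import Mathlib

open CategoryTheory Quiver
open scoped lp

universe u v

noncomputable section

/-! ### Operator-valued moments and cumulants over noncrossing partitions -/

/-- Noncrossing partitions of `{0, …, n - 1}`, written as equivalence relations. -/
def NCPartition (n : ℕ) : Type :=
  {π : Setoid (Fin n) // ∀ i j k l : Fin n, i < j → j < k → k < l → π i k → π j l → π i j}

namespace NCPartition

/-- `π ≤ θ` iff every block of `π` lies in a block of `θ`. -/
instance (n : ℕ) : PartialOrder (NCPartition n) :=
  inferInstanceAs (PartialOrder {π : Setoid (Fin n) //
    ∀ i j k l : Fin n, i < j → j < k → k < l → π i k → π j l → π i j})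

/-- The partition with a single block. -/
def one (n : ℕ) : NCPartition n := ⟨⊤, fun _ _ _ _ _ _ _ _ _ => trivial⟩

instance (n : ℕ) : Finite (NCPartition n) := by
  refine Finite.of_injective (β := Fin n → Fin n → Prop) (fun π => ⇑π.1) ?_
  intro π θ h
  exact Subtype.ext (Setoid.ext fun a b => iff_of_eq (congrFun (congrFun h a) b))

instance (n : ℕ) : Fintype (NCPartition n) := Fintype.ofFinite _

instance (n : ℕ) : DecidableEq (NCPartition n) := Classical.decEq _

instance (n : ℕ) : LocallyFiniteOrder (NCPartition n) :=
  haveI : DecidableLE (NCPartition n) := Classical.decRel _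
  haveI : DecidableLT (NCPartition n) := Classical.decRel _
  Fintype.toLocallyFiniteOrder

/-- The value `μ(π, 1_n)` of the Moebius function of the lattice of noncrossing partitions. -/
def moebius {n : ℕ} (π : NCPartition n) : ℂ :=
  (IncidenceAlgebra.mu ℂ : IncidenceAlgebra ℂ (NCPartition n)) π (one n)

/-- `i` and `j` are positions below `n` in the same block. -/
def SameBlock {n : ℕ} (π : NCPartition n) (i j : ℕ) : Prop :=
  ∃ (hi : i < n) (hj : j < n), π.1 ⟨i, hi⟩ ⟨j, hj⟩

end NCPartition

open Classical in
/-- The last position below `q` that is related to `p` (and `p` itself if there is none). -/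
def lastInBlock (r : ℕ → ℕ → Prop) (p q : ℕ) : ℕ :=
  max p (((Finset.Ico p q).filter (r p)).sup id)

open Classical in
mutual
/-- The nested moment of the positions `p, …, q - 1`: with `p = i₁ < ⋯ < iₖ` the block of `p`, it is
`E(a_{i₁} M(i₁ + 1, i₂) a_{i₂} M(i₂ + 1, i₃) ⋯ a_{iₖ}) * M(iₖ + 1, q)`, and `1` if `q ≤ p`. -/
def nestedMoment {A : Type*} [Semiring A] [Algebra ℂ A] {B : Subalgebra ℂ A} (E : A → B)
    (r : ℕ → ℕ → Prop) (a : ℕ → A) (p q : ℕ) : B :=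
  if p < q then
    E (blockProduct E r a p q) * nestedMoment E r a (lastInBlock r p q + 1) q
  else 1
termination_by (q - p, 1)
decreasing_by
  · exact Prod.Lex.right _ (by omega)
  · refine Prod.Lex.left _ _ ?_
    have : p ≤ lastInBlock r p q := le_max_left _ _
    omega

/-- The product `a_{i₁} M(i₁ + 1, i₂) a_{i₂} ⋯ a_{iₖ}`, where `i = i₁ < ⋯ < iₖ` are the positions in
`[i, q)` that lie in the block of `i`. -/
def blockProduct {A : Type*} [Semiring A] [Algebra ℂ A] {B : Subalgebra ℂ A} (E : A → B)
    (r : ℕ → ℕ → Prop) (a : ℕ → A) (i q : ℕ) : A :=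
  if h : ∃ j, i < j ∧ j < q ∧ r i j then
    a i * (nestedMoment E r a (i + 1) (Nat.find h) : A) * blockProduct E r a (Nat.find h) q
  else a i
termination_by (q - i, 0)
decreasing_by
  · refine Prod.Lex.left _ _ ?_
    have := Nat.find_spec h
    omega
  · refine Prod.Lex.left _ _ ?_
    have := Nat.find_spec h
    omega
end

/-- The partition-dependent moment `E_π(a_1, …, a_n)`. For `π = {(1, 4), (2, 3), (5)}` it is
`E(a_1 E(a_2 a_3) a_4) E(a_5)`. -/
def partitionMoment {A : Type*} [Semiring A] [Algebra ℂ A] {B : Subalgebra ℂ A} (E : A → B) {n : ℕ}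
    (π : NCPartition n) (a : Fin n → A) : B :=
  nestedMoment E π.SameBlock (fun i => if h : i < n then a ⟨i, h⟩ else 1) 0 n

/-- The operator-valued free cumulant `k_n(a_1, …, a_n) = ∑_π μ(π, 1_n) E_π(a_1, …, a_n)`. -/
def freeCumulant {A : Type*} [Semiring A] [Algebra ℂ A] {B : Subalgebra ℂ A} (E : A → B) {n : ℕ}
    (a : Fin n → A) : B :=
  ∑ π : NCPartition n, π.moebius • partitionMoment E π a

/-! ### Von Neumann algebras generated by sets and strong sums of operators -/

section Operators

variable {H : Type*} [NormedAddCommGroup H] [InnerProductSpace ℂ H]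

/-- The von Neumann algebra generated by a set `S`: the double commutant of `S ∪ S*`. -/
def vonNeumannGenerated [CompleteSpace H] (S : Set (H →L[ℂ] H)) : VonNeumannAlgebra H where
  toStarSubalgebra := StarSubalgebra.centralizer ℂ (StarSubalgebra.centralizer ℂ S : Set (H →L[ℂ] H))
  centralizer_centralizer' := by
    change Set.centralizer (Set.centralizer ((StarSubalgebra.centralizer ℂ
      (StarSubalgebra.centralizer ℂ S : Set (H →L[ℂ] H)) : StarSubalgebra ℂ (H →L[ℂ] H)) :
        Set (H →L[ℂ] H))) = ((StarSubalgebra.centralizer ℂ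
      (StarSubalgebra.centralizer ℂ S : Set (H →L[ℂ] H)) : StarSubalgebra ℂ (H →L[ℂ] H)) :
        Set (H →L[ℂ] H))
    rw [StarSubalgebra.coe_centralizer_centralizer, Set.centralizer_centralizer_centralizer]

theorem subset_vonNeumannGenerated [CompleteSpace H] (S : Set (H →L[ℂ] H)) {x : H →L[ℂ] H} (hx : x ∈ S) :
    x ∈ (vonNeumannGenerated S).toStarSubalgebra := by
  change x ∈ ((StarSubalgebra.centralizer ℂ
    (StarSubalgebra.centralizer ℂ S : Set (H →L[ℂ] H)) : StarSubalgebra ℂ (H →L[ℂ] H)) :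
      Set (H →L[ℂ] H))
  rw [StarSubalgebra.coe_centralizer_centralizer]
  exact Set.subset_centralizer_centralizer (Or.inl hx)

theorem vonNeumannGenerated_mono [CompleteSpace H] {S T : Set (H →L[ℂ] H)} (h : S ⊆ T) :
    (vonNeumannGenerated S).toStarSubalgebra ≤ (vonNeumannGenerated T).toStarSubalgebra :=
  StarSubalgebra.centralizer_le ℂ _ _ (StarSubalgebra.centralizer_le ℂ _ _ h)

open Classical in
/-- The sum of a family of bounded operators in the strong operator topology (summed over the net
of finite subfamilies), with value `0` if the family is not summable. -/
def strongSum {J : Type*} (A : J → H →L[ℂ] H) : H →L[ℂ] H :=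
  if h : ∃ T : H →L[ℂ] H, ∀ ξ, HasSum (fun j => A j ξ) (T ξ) then h.choose else 0

theorem strongSum_eq {J : Type*} {A : J → H →L[ℂ] H} {T : H →L[ℂ] H}
    (hT : ∀ ξ, HasSum (fun j => A j ξ) (T ξ)) : strongSum A = T := by
  have h : ∃ T : H →L[ℂ] H, ∀ ξ, HasSum (fun j => A j ξ) (T ξ) := ⟨T, hT⟩
  rw [strongSum, dif_pos h]
  ext1 ξ
  exact (h.choose_spec ξ).unique (hT ξ)

/-- A von Neumann algebra contains the strong sums of its elements. -/
theorem strongSum_mem [CompleteSpace H] {J : Type*} (M : VonNeumannAlgebra H) {A : J → H →L[ℂ] H}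
    (hA : ∀ j, A j ∈ M.toStarSubalgebra) : strongSum A ∈ M.toStarSubalgebra := by
  by_cases h : ∃ T : H →L[ℂ] H, ∀ ξ, HasSum (fun j => A j ξ) (T ξ)
  · obtain ⟨T, hT⟩ := h
    rw [strongSum_eq hT]
    change T ∈ (M : Set (H →L[ℂ] H))
    rw [← M.centralizer_centralizer]
    intro S hS
    ext1 ξ
    have h1 : HasSum (fun j => S (A j ξ)) (S (T ξ)) := S.hasSum (hT ξ)
    have h2 : (fun j => S (A j ξ)) = fun j => A j (S ξ) := by
      funext j
      have := hS (A j) (hA j)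
      exact (DFunLike.congr_fun this ξ).symm
    rw [h2] at h1
    exact h1.unique (hT (S ξ))
  · rw [strongSum, dif_neg h]
    exact zero_mem _

end Operators

/-! ### The graph groupoid, its Hilbert space, and right multiplication operators -/

section Graph

/-- The edges of the shadowed graph: an edge from `a` to `b` is an edge `a ⟶ b` of the graph
(`Sum.inl`) or the shadow of an edge `b ⟶ a` (`Sum.inr`). -/
abbrev ShadowedEdge (V : Type u) [Quiver.{v} V] := Quiver.Total (Quiver.Symmetrify V)

/-- The shadow `e⁻¹` of an edge `e` of the shadowed graph. -/
def ShadowedEdge.inv {V : Type u} [Quiver.{v} V] (e : ShadowedEdge V) : ShadowedEdge V :=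
  ⟨e.right, e.left, Quiver.reverse e.hom⟩

/-- The nonempty elements of the graph groupoid: vertices and reduced paths of the shadowed graph,
that is, all arrows of the free groupoid on the graph. The empty element is added as `none` in
`Option (GraphGroupoid V)`. -/
abbrev GraphGroupoid (V : Type u) [Quiver.{v} V] := Quiver.Total (Quiver.FreeGroupoid V)

namespace GraphGroupoid

variable {V : Type u} [Quiver.{v} V]

/-- The unit of the groupoid at an object. -/
def unit (a : Quiver.FreeGroupoid V) : GraphGroupoid V := ⟨a, a, 𝟙 a⟩

/-- A vertex as an element of the groupoid. -/
def vertex (a : V) : GraphGroupoid V := unit ⟨a⟩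

/-- An edge of the shadowed graph as an element of the groupoid. -/
def ofEdge (e : ShadowedEdge V) : GraphGroupoid V :=
  ⟨⟨e.left⟩, ⟨e.right⟩, (Quotient.functor (@Quiver.FreeGroupoid.redStep V _)).map e.hom.toPath⟩

/-- The inverse of an element. -/
def inv (g : GraphGroupoid V) : GraphGroupoid V := ⟨g.right, g.left, Groupoid.inv g.hom⟩

open Classical in
/-- The product `g h` (first `g`, then `h`), which is empty unless `g` ends where `h` starts. -/
def mul (g h : GraphGroupoid V) : Option (GraphGroupoid V) :=
  if H : g.right = h.left then some ⟨g.left, h.right, g.hom ≫ eqToHom H ≫ h.hom⟩ else none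

/-- The element of the groupoid, or the empty element, given by a nonempty word in the edges. -/
def ofWord : List (ShadowedEdge V) → Option (GraphGroupoid V)
  | [] => none
  | [e] => some (ofEdge e)
  | e :: l => (ofWord l).bind (mul (ofEdge e))

theorem inv_inv (h : GraphGroupoid V) : h.inv.inv = h := by
  obtain ⟨c, d, f⟩ := h
  simp [inv]

theorem mul_inv_of_mul {g h k : GraphGroupoid V} (H : mul g h = some k) :
    mul k h.inv = some g := by
  obtain ⟨a, b, f⟩ := g
  obtain ⟨c, d, f'⟩ := h
  obtain ⟨x, y, f''⟩ := k
  simp only [mul, inv] at H ⊢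
  by_cases h1 : b = c
  swap
  · rw [dif_neg h1] at H
    cases H
  rw [dif_pos h1] at H
  subst h1
  simp only [Option.some.injEq, Total.mk.injEq] at H
  obtain ⟨rfl, rfl, H⟩ := H
  obtain rfl := eq_of_heq H
  simp

theorem mul_eq_some_iff {g h k : GraphGroupoid V} : mul g h = some k ↔ mul k h.inv = some g :=
  ⟨mul_inv_of_mul, fun H => by simpa only [inv_inv] using mul_inv_of_mul H⟩

end GraphGroupoid

/-- The graph Hilbert space, with an orthonormal basis indexed by the graph groupoid. -/
abbrev GraphHilbert (V : Type u) [Quiver.{v} V] := lp (fun _ : GraphGroupoid V => ℂ) 2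

variable {V : Type u} [Quiver.{v} V]

open Classical in
/-- The basis vector `ξ_g`. -/
def basisVec (g : GraphGroupoid V) : GraphHilbert V := lp.single 2 g 1

theorem sum_elim_sq_le {ι : Type*} (f : ι → Option ι)
    (hf : ∀ a b k, f a = some k → f b = some k → a = b) (x : lp (fun _ : ι => ℂ) 2)
    (s : Finset ι) :
    ∑ i ∈ s, ‖(f i).elim 0 x‖ ^ (2 : ENNReal).toReal ≤ ‖x‖ ^ (2 : ENNReal).toReal := by
  classical
  let t : Finset ι := s.filterMap f hf
  refine le_trans (le_of_eq ?_) (lp.sum_rpow_le_norm_rpow (by norm_num) x t)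
  symm
  refine Finset.sum_of_injOn (s := t) (fun k => (if h : ∃ a ∈ s, f a = some k then h.choose else k))
    ?_ ?_ ?_ ?_
  · intro k hk l hl hkl
    have hk' : ∃ a ∈ s, f a = some k := by simpa [t] using hk
    have hl' : ∃ a ∈ s, f a = some l := by simpa [t] using hl
    simp only [dif_pos hk', dif_pos hl'] at hkl
    have h1 := hk'.choose_spec.2
    rw [hkl, hl'.choose_spec.2] at h1
    exact (Option.some.inj h1).symm
  · intro k hk
    have hk' : ∃ a ∈ s, f a = some k := by simpa [t] using hk
    simp only [dif_pos hk']
    exact hk'.choose_spec.1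
  · intro i hi hi'
    rcases hfi : f i with _ | k
    · simp
    · exfalso
      apply hi'
      have hk' : ∃ a ∈ s, f a = some k := ⟨i, hi, hfi⟩
      refine ⟨k, by simpa [t] using hk', ?_⟩
      simp only [dif_pos hk']
      exact hf _ _ _ hk'.choose_spec.2 hfi
  · intro k hk
    have hk' : ∃ a ∈ s, f a = some k := by simpa [t] using hk
    simp only [dif_pos hk', hk'.choose_spec.2, Option.elim_some]

theorem mul_inv_inj (w : GraphGroupoid V) (a b k : GraphGroupoid V)
    (ha : a.mul w.inv = some k) (hb : b.mul w.inv = some k) : a = b := by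
  rw [← GraphGroupoid.mul_eq_some_iff] at ha hb
  exact Option.some.inj (ha.symm.trans hb)

/-- The right multiplication operator `R_w`, given by `(R_w x)(g) = x(g w⁻¹)`, or `0` if `g w⁻¹` is
empty. Its action on the basis is in `rightMul_basisVec`. -/
def rightMul (w : GraphGroupoid V) : GraphHilbert V →L[ℂ] GraphHilbert V :=
  LinearMap.mkContinuous
    { toFun := fun x => ⟨fun g => (g.mul w.inv).elim 0 x,
        memℓp_gen' (sum_elim_sq_le _ (mul_inv_inj w) x)⟩
      map_add' := by
        intro x y
        ext g
        change (g.mul w.inv).elim 0 (x + y) = (g.mul w.inv).elim 0 x + (g.mul w.inv).elim 0 y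
        rcases g.mul w.inv with _ | k
        · exact (add_zero 0).symm
        · rfl
      map_smul' := by
        intro c x
        ext g
        change (g.mul w.inv).elim 0 (c • x) = c • (g.mul w.inv).elim 0 x
        rcases g.mul w.inv with _ | k
        · exact (smul_zero c).symm
        · rfl }
    1 (by
      intro x
      rw [one_mul]
      exact lp.norm_le_of_forall_sum_le (by norm_num) (norm_nonneg _)
        (sum_elim_sq_le _ (mul_inv_inj w) x))

/-- `R_w ξ_g = ξ_{g w}`, where `ξ` of the empty element is `0`. -/
theorem rightMul_basisVec (w g : GraphGroupoid V) :
    rightMul w (basisVec g) = (g.mul w).elim 0 basisVec := by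
  classical
  ext k
  change (k.mul w.inv).elim 0 (basisVec g) = _
  rcases h : k.mul w.inv with _ | m
  · rcases h' : g.mul w with _ | m'
    · simp
    · have : k ≠ m' := by
        rintro rfl
        rw [GraphGroupoid.mul_eq_some_iff, h] at h'
        cases h'
      simp [basisVec, lp.single_apply, this]
  · rw [← GraphGroupoid.mul_eq_some_iff] at h
    rcases h' : g.mul w with _ | m'
    · have : m ≠ g := by
        rintro rfl
        rw [h] at h'
        cases h'
      simp [basisVec, lp.single_apply, this]
    · have : m = g ↔ k = m' := by
        constructor
        · rintro rfl
          rw [h] at h'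
          exact Option.some.inj h'
        · rintro rfl
          rw [GraphGroupoid.mul_eq_some_iff] at h h'
          rw [h] at h'
          exact Option.some.inj h'
      simp [basisVec, lp.single_apply, Pi.single_apply, this]

section Convergence

theorem rightMul_apply (w : GraphGroupoid V) (x : GraphHilbert V) (g : GraphGroupoid V) :
    rightMul w x g = (g.mul w.inv).elim 0 x := rfl

theorem norm_rightMul_le (w : GraphGroupoid V) (x : GraphHilbert V) : ‖rightMul w x‖ ≤ ‖x‖ := by
  refine lp.norm_le_of_forall_sum_le (by norm_num) (norm_nonneg _) ?_
  exact sum_elim_sq_le _ (mul_inv_inj w) x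

theorem rightMul_unit_apply (a : Quiver.FreeGroupoid V) (x : GraphHilbert V)
    (g : GraphGroupoid V) [Decidable (g.right = a)] :
    rightMul (GraphGroupoid.unit a) x g = if g.right = a then x g else 0 := by
  rw [rightMul_apply]
  obtain ⟨c, d, f⟩ := g
  by_cases h : d = a
  · subst h
    have : GraphGroupoid.mul ⟨c, _, f⟩ (GraphGroupoid.unit d).inv = some ⟨c, _, f⟩ := by
      rw [← GraphGroupoid.mul_eq_some_iff]
      refine (dif_pos rfl).trans ?_
      simp [GraphGroupoid.unit]
    rw [this, if_pos rfl]
    rfl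
  · have : GraphGroupoid.mul ⟨c, d, f⟩ (GraphGroupoid.unit a).inv = none := dif_neg h
    rw [this, if_neg h]
    rfl

theorem rightMul_apply_eq_zero (w : GraphGroupoid V) (x : GraphHilbert V) (g : GraphGroupoid V)
    (h : w.right ≠ g.right) : rightMul w x g = 0 := by
  have : g.mul w.inv = none := dif_neg fun h' => h h'.symm
  rw [rightMul_apply, this]
  rfl

theorem rightMul_rightMul_unit (w : GraphGroupoid V) (x : GraphHilbert V) :
    rightMul w (rightMul (GraphGroupoid.unit w.left) x) = rightMul w x := by
  classical
  ext g
  rw [rightMul_apply, rightMul_apply]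
  rcases h : g.mul w.inv with _ | k
  · rfl
  · rw [Option.elim_some, Option.elim_some, rightMul_unit_apply, if_pos]
    unfold GraphGroupoid.mul at h
    split_ifs at h
    cases h
    rfl

theorem norm_sq_eq_tsum (x : GraphHilbert V) : HasSum (fun g => ‖x g‖ ^ 2) (‖x‖ ^ 2) := by
  have := lp.hasSum_norm (p := 2) (by norm_num) x
  simpa using this

theorem sum_norm_sq_rightMul_le {J : Type*} (w : J → GraphGroupoid V) (D : ℕ)
    (hL : ∀ (a : Quiver.FreeGroupoid V) (F : Finset J), (∀ j ∈ F, (w j).left = a) → F.card ≤ D)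
    (x : GraphHilbert V) (F : Finset J) :
    ∑ j ∈ F, ‖rightMul (w j) x‖ ^ 2 ≤ D * ‖x‖ ^ 2 := by
  classical
  have h1 : ∀ j ∈ F, ‖rightMul (w j) x‖ ^ 2 ≤
      ‖rightMul (GraphGroupoid.unit (w j).left) x‖ ^ 2 := by
    intro j _
    rw [← rightMul_rightMul_unit (w j) x]
    exact pow_le_pow_left₀ (norm_nonneg _) (norm_rightMul_le _ _) 2
  refine (Finset.sum_le_sum h1).trans ?_
  have h2 : HasSum (fun g => ∑ j ∈ F, ‖rightMul (GraphGroupoid.unit (w j).left) x g‖ ^ 2)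
      (∑ j ∈ F, ‖rightMul (GraphGroupoid.unit (w j).left) x‖ ^ 2) :=
    hasSum_sum fun j _ => norm_sq_eq_tsum _
  refine hasSum_le ?_ h2 ((norm_sq_eq_tsum x).mul_left (D : ℝ))
  intro g
  have h3 : ∀ j ∈ F, ‖rightMul (GraphGroupoid.unit (w j).left) x g‖ ^ 2 =
      if (w j).left = g.right then ‖x g‖ ^ 2 else 0 := by
    intro j _
    rw [rightMul_unit_apply]
    by_cases h : (w j).left = g.right
    · rw [if_pos h, if_pos h.symm]
    · rw [if_neg h, if_neg fun h' => h h'.symm]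
      simp
  rw [Finset.sum_congr rfl h3, ← Finset.sum_filter, Finset.sum_const, nsmul_eq_mul]
  refine mul_le_mul_of_nonneg_right ?_ (by positivity)
  exact_mod_cast hL g.right _ fun j hj => (Finset.mem_filter.1 hj).2

theorem norm_sum_rightMul_sq_le {J : Type*} (w : J → GraphGroupoid V) (c : J → ℂ) (C : ℝ) (D : ℕ)
    (hc : ∀ j, ‖c j‖ ≤ C)
    (hR : ∀ (a : Quiver.FreeGroupoid V) (F : Finset J), (∀ j ∈ F, (w j).right = a) → F.card ≤ D)
    (x : GraphHilbert V) (F : Finset J) :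
    ‖∑ j ∈ F, c j • rightMul (w j) x‖ ^ 2 ≤ D * C ^ 2 * ∑ j ∈ F, ‖rightMul (w j) x‖ ^ 2 := by
  classical
  have h2 : HasSum (fun g => ∑ j ∈ F, ‖rightMul (w j) x g‖ ^ 2)
      (∑ j ∈ F, ‖rightMul (w j) x‖ ^ 2) :=
    hasSum_sum fun j _ => norm_sq_eq_tsum _
  refine hasSum_le ?_ (norm_sq_eq_tsum _) (h2.mul_left (D * C ^ 2))
  intro g
  have h0 : (∑ j ∈ F, c j • rightMul (w j) x : GraphHilbert V) g =
      ∑ j ∈ F with (w j).right = g.right, c j * rightMul (w j) x g := by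
    rw [lp.coeFn_sum, Finset.sum_apply, Finset.sum_filter]
    refine Finset.sum_congr rfl fun j _ => ?_
    split_ifs with h
    · rfl
    · simp [rightMul_apply_eq_zero _ x g h]
  rw [h0]
  have hcard := hR g.right (F.filter fun j => (w j).right = g.right)
    fun j hj => (Finset.mem_filter.1 hj).2
  calc ‖∑ j ∈ F with (w j).right = g.right, c j * rightMul (w j) x g‖ ^ 2
      ≤ (∑ j ∈ F with (w j).right = g.right, ‖c j * rightMul (w j) x g‖) ^ 2 :=
        pow_le_pow_left₀ (norm_nonneg _) (norm_sum_le _ _) 2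
    _ ≤ (F.filter fun j => (w j).right = g.right).card *
          ∑ j ∈ F with (w j).right = g.right, ‖c j * rightMul (w j) x g‖ ^ 2 :=
        sq_sum_le_card_mul_sum_sq
    _ ≤ D * ∑ j ∈ F, C ^ 2 * ‖rightMul (w j) x g‖ ^ 2 := by
        refine mul_le_mul (by exact_mod_cast hcard) ?_ (by positivity) (by positivity)
        refine (Finset.sum_le_sum_of_subset_of_nonneg (Finset.filter_subset _ _)
          fun _ _ _ => by positivity).trans ?_
        refine Finset.sum_le_sum fun j _ => ?_
        rw [norm_mul, mul_pow]
        exact mul_le_mul_of_nonneg_right (pow_le_pow_left₀ (norm_nonneg _) (hc j) 2) (by positivity)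
    _ = D * C ^ 2 * ∑ j ∈ F, ‖rightMul (w j) x g‖ ^ 2 := by
        rw [← Finset.mul_sum, mul_assoc]

/-- A family `c_j R_{w_j}` with bounded coefficients, in which a bounded number of the `w_j` start at
each vertex and a bounded number end there, has a strong sum. -/
theorem hasSum_strongSum_rightMul {J : Type*} (w : J → GraphGroupoid V) (c : J → ℂ) (C : ℝ) (D : ℕ)
    (hc : ∀ j, ‖c j‖ ≤ C)
    (hL : ∀ (a : Quiver.FreeGroupoid V) (F : Finset J), (∀ j ∈ F, (w j).left = a) → F.card ≤ D)
    (hR : ∀ (a : Quiver.FreeGroupoid V) (F : Finset J), (∀ j ∈ F, (w j).right = a) → F.card ≤ D)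
    (x : GraphHilbert V) :
    HasSum (fun j => (c j • rightMul (w j)) x) (strongSum (fun j => c j • rightMul (w j)) x) := by
  classical
  have hsq : ∀ x : GraphHilbert V, Summable fun j => ‖rightMul (w j) x‖ ^ 2 := fun x =>
    summable_of_sum_le (fun _ => by positivity) (sum_norm_sq_rightMul_le w D hL x)
  have hs : ∀ x : GraphHilbert V, Summable fun j => (c j • rightMul (w j)) x := by
    intro x
    rw [summable_iff_vanishing_norm]
    intro ε hε
    have hpos : 0 < ε ^ 2 / (D * C ^ 2 + 1) := by positivity
    obtain ⟨s, hs⟩ := summable_iff_vanishing_norm.1 (hsq x) _ hpos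
    refine ⟨s, fun t ht => ?_⟩
    have h1 := hs t ht
    rw [Real.norm_of_nonneg (Finset.sum_nonneg fun _ _ => by positivity),
      lt_div_iff₀ (by positivity)] at h1
    have h2 := norm_sum_rightMul_sq_le w c C D hc hR x t
    have h3 : (0 : ℝ) ≤ ∑ j ∈ t, ‖rightMul (w j) x‖ ^ 2 :=
      Finset.sum_nonneg fun _ _ => by positivity
    refine lt_of_pow_lt_pow_left₀ 2 hε.le ?_
    calc ‖∑ j ∈ t, (c j • rightMul (w j)) x‖ ^ 2 ≤ _ := h2
      _ ≤ _ := by nlinarith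
      _ < ε ^ 2 := h1
  have hb : ∀ x : GraphHilbert V, ‖∑' j, (c j • rightMul (w j)) x‖ ≤ D * |C| * ‖x‖ := by
    intro x
    refine le_of_tendsto (hs x).hasSum.norm (Filter.Eventually.of_forall fun F => ?_)
    refine le_of_sq_le_sq ?_ (by positivity)
    calc ‖∑ j ∈ F, (c j • rightMul (w j)) x‖ ^ 2
        ≤ D * C ^ 2 * ∑ j ∈ F, ‖rightMul (w j) x‖ ^ 2 := norm_sum_rightMul_sq_le w c C D hc hR x F
      _ ≤ D * C ^ 2 * (D * ‖x‖ ^ 2) :=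
        mul_le_mul_of_nonneg_left (sum_norm_sq_rightMul_le w D hL x F) (by positivity)
      _ = (D * |C| * ‖x‖) ^ 2 := by rw [mul_pow, mul_pow, sq_abs]; ring
  let T : GraphHilbert V →L[ℂ] GraphHilbert V := LinearMap.mkContinuous
    { toFun := fun x => ∑' j, (c j • rightMul (w j)) x
      map_add' := by
        intro x y
        simp only [map_add]
        exact (hs x).tsum_add (hs y)
      map_smul' := by
        intro a x
        simp only [map_smul]
        exact (hs x).tsum_const_smul a } (D * |C|) hb
  have hT : ∀ x, HasSum (fun j => (c j • rightMul (w j)) x) (T x) := fun x => (hs x).hasSum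
  rw [strongSum_eq hT]
  exact hT x

end Convergence

variable (V) in
/-- The right graph von Neumann algebra `M_G`, generated by all right multiplication operators. -/
def rightGraphVN : VonNeumannAlgebra (GraphHilbert V) :=
  vonNeumannGenerated (Set.range (rightMul (V := V)))

variable (V) in
/-- `M_G` as a star subalgebra. -/
abbrev RightGraphAlg : StarSubalgebra ℂ (GraphHilbert V →L[ℂ] GraphHilbert V) :=
  (rightGraphVN V).toStarSubalgebra

variable (V) in
/-- The von Neumann algebra generated by the vertex projections `R_v`. -/
def diagonalVN : VonNeumannAlgebra (GraphHilbert V) :=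
  vonNeumannGenerated (Set.range fun a : V => rightMul (GraphGroupoid.vertex a))

variable (V) in
/-- The diagonal subalgebra `D_G` of `M_G`. -/
def diagonalSubalgebra : Subalgebra ℂ (RightGraphAlg V) :=
  (diagonalVN V).toStarSubalgebra.toSubalgebra.comap (RightGraphAlg V).subtype.toAlgHom

theorem diagonalVN_le : (diagonalVN V).toStarSubalgebra ≤ RightGraphAlg V := by
  apply vonNeumannGenerated_mono
  rintro _ ⟨a, rfl⟩
  exact ⟨_, rfl⟩

/-- The diagonal part `∑_v m_v R_v` of an operator (as a strong sum), where `m_v` is the coefficient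
of `ξ_v` in `x ξ_v`; this is the coefficient of `R_v` if `x = ∑_w m_w R_w`. -/
def diagonalPart (x : GraphHilbert V →L[ℂ] GraphHilbert V) :
    GraphHilbert V →L[ℂ] GraphHilbert V :=
  strongSum fun a : V =>
    (x (basisVec (GraphGroupoid.vertex a)) (GraphGroupoid.vertex a)) •
      rightMul (GraphGroupoid.vertex a)

theorem diagonalPart_mem (x : GraphHilbert V →L[ℂ] GraphHilbert V) :
    diagonalPart x ∈ (diagonalVN V).toStarSubalgebra :=
  strongSum_mem _ fun a =>
    (diagonalVN V).toStarSubalgebra.smul_mem (subset_vonNeumannGenerated _ ⟨a, rfl⟩) _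

theorem norm_basisVec (g : GraphGroupoid V) : ‖basisVec g‖ = 1 := by
  classical
  rw [basisVec, lp.norm_single (by norm_num)]
  simp

/-- The strong sum that defines the diagonal part converges for every bounded operator. -/
theorem hasSum_diagonalPart (x : GraphHilbert V →L[ℂ] GraphHilbert V) (ξ : GraphHilbert V) :
    HasSum (fun a : V => ((x (basisVec (GraphGroupoid.vertex a)) (GraphGroupoid.vertex a)) •
      rightMul (GraphGroupoid.vertex a)) ξ) (diagonalPart x ξ) := by
  have key : ∀ (a : Quiver.FreeGroupoid V) (F : Finset V),
      (∀ j ∈ F, (⟨j⟩ : Quiver.FreeGroupoid V) = a) → F.card ≤ 1 := by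
    intro a F h
    rw [Finset.card_le_one]
    intro i hi j hj
    have := (h i hi).trans (h j hj).symm
    injection this
  refine hasSum_strongSum_rightMul (fun a : V => GraphGroupoid.vertex a) _ ‖x‖ 1 (fun a => ?_)
    key key ξ
  refine (lp.norm_apply_le_norm (by norm_num) _ _).trans ((x.le_opNorm _).trans ?_)
  rw [norm_basisVec, mul_one]

/-- The canonical conditional expectation `E : M_G → D_G`, `E(∑_w m_w R_w) = ∑_v m_v R_v`. -/
def condExpDiag (x : RightGraphAlg V) : diagonalSubalgebra V :=
  ⟨⟨diagonalPart x.1, diagonalVN_le (diagonalPart_mem x.1)⟩, diagonalPart_mem x.1⟩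

/-- `R_w` as an element of `M_G`. -/
def rightMulAlg (w : GraphGroupoid V) : RightGraphAlg V :=
  ⟨rightMul w, subset_vonNeumannGenerated _ ⟨w, rfl⟩⟩

/-- `R_w` for an element `w` of the groupoid with the empty element, where `R_∅ = 0`. -/
def rightMulOpt (w : Option (GraphGroupoid V)) : RightGraphAlg V := w.elim 0 rightMulAlg

/-! ### Labels and labeling operators -/

variable (V) in
/-- A canonical weighting: for each vertex `a`, the edges that start at `a` are labelled bijectively
by `1, …, deg_out(a)`. -/
structure CanonicalWeighting where
  /-- The label of an edge. -/
  label : ∀ {a b : V}, (a ⟶ b) → ℕ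
  bijOn : ∀ a : V, Set.BijOn (fun e : Quiver.Star a => label e.2) Set.univ
    (Set.Icc 1 (Nat.card (Quiver.Star a)))

/-- The label on the shadowed graph: `k` stands for `l_k`, and `e⁻¹` has label `l_{-k}` if `e` has
label `l_k`. -/
def CanonicalWeighting.shadowLabel (ω : CanonicalWeighting V) (e : ShadowedEdge V) : ℤ :=
  Sum.elim (fun f : (show V from e.left) ⟶ (show V from e.right) => (ω.label f : ℤ))
    (fun f : (show V from e.right) ⟶ (show V from e.left) => -(ω.label f : ℤ)) e.hom

variable (V) in
/-- The maximal out-degree `N`. -/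
def maxOutDegree : ℕ := ⨆ a : V, Nat.card (Quiver.Star a)

/-- The `k`-th labeling operator `T_k`, the (strong) sum of all `R_e` with `e` of label `l_k`. -/
def labelingOperatorAt (ω : CanonicalWeighting V) (k : ℤ) : RightGraphAlg V :=
  ⟨strongSum fun e : {e : ShadowedEdge V // ω.shadowLabel e = k} =>
      rightMul (GraphGroupoid.ofEdge e.1),
    strongSum_mem _ fun _ => subset_vonNeumannGenerated _ ⟨_, rfl⟩⟩

theorem card_le_of_left {D : ℕ} (a : V)
    (h : ENat.card (Quiver.Star a) ≤ (D : ℕ∞) ∧ ENat.card (Quiver.Costar a) ≤ (D : ℕ∞))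
    (F : Finset (ShadowedEdge V)) :
    ((∀ e ∈ F, e.left = a) → F.card ≤ 2 * D) ∧ ((∀ e ∈ F, e.right = a) → F.card ≤ 2 * D) := by
  classical
  have : Finite (Quiver.Star a) := by
    rw [← ENat.card_lt_top]
    exact h.1.trans_lt (ENat.natCast_lt_top D)
  have : Finite (Quiver.Costar a) := by
    rw [← ENat.card_lt_top]
    exact h.2.trans_lt (ENat.natCast_lt_top D)
  have := Fintype.ofFinite (Quiver.Star a)
  have := Fintype.ofFinite (Quiver.Costar a)
  have hcard : Fintype.card (Quiver.Star a ⊕ Quiver.Costar a) ≤ 2 * D := by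
    have h1 := h.1
    have h2 := h.2
    rw [ENat.card_eq_coe_fintype_card] at h1 h2
    rw [Fintype.card_sum]
    have h1' : Fintype.card (Quiver.Star a) ≤ D := by exact_mod_cast h1
    have h2' : Fintype.card (Quiver.Costar a) ≤ D := by exact_mod_cast h2
    omega
  constructor
  · intro hF
    let φ : Quiver.Star a ⊕ Quiver.Costar a → ShadowedEdge V :=
      Sum.elim (fun e => ⟨a, e.1, Sum.inl e.2⟩) (fun e => ⟨a, e.1, Sum.inr e.2⟩)
    have hsub : F ⊆ Finset.univ.image φ := by
      intro e he
      have hea := hF e he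
      obtain ⟨b, c, f⟩ := e
      change b = a at hea
      subst hea
      rcases f with f | f
      · exact Finset.mem_image.2 ⟨Sum.inl ⟨c, f⟩, Finset.mem_univ _, rfl⟩
      · exact Finset.mem_image.2 ⟨Sum.inr ⟨c, f⟩, Finset.mem_univ _, rfl⟩
    exact (Finset.card_le_card hsub).trans (Finset.card_image_le.trans hcard)
  · intro hF
    let φ : Quiver.Star a ⊕ Quiver.Costar a → ShadowedEdge V :=
      Sum.elim (fun e => ⟨e.1, a, Sum.inr e.2⟩) (fun e => ⟨e.1, a, Sum.inl e.2⟩)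
    have hsub : F ⊆ Finset.univ.image φ := by
      intro e he
      have hea := hF e he
      obtain ⟨b, c, f⟩ := e
      change c = a at hea
      subst hea
      rcases f with f | f
      · exact Finset.mem_image.2 ⟨Sum.inr ⟨b, f⟩, Finset.mem_univ _, rfl⟩
      · exact Finset.mem_image.2 ⟨Sum.inl ⟨b, f⟩, Finset.mem_univ _, rfl⟩
    exact (Finset.card_le_card hsub).trans (Finset.card_image_le.trans hcard)

/-- If the degrees are bounded, then the strong sum that defines `T_k` converges. -/
theorem hasSum_labelingOperatorAt {D : ℕ} (hdeg : ∀ a : V,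
      ENat.card (Quiver.Star a) ≤ (D : ℕ∞) ∧ ENat.card (Quiver.Costar a) ≤ (D : ℕ∞))
    (ω : CanonicalWeighting V) (k : ℤ) (ξ : GraphHilbert V) :
    HasSum (fun e : {e : ShadowedEdge V // ω.shadowLabel e = k} =>
      rightMul (GraphGroupoid.ofEdge e.1) ξ) ((labelingOperatorAt ω k).1 ξ) := by
  classical
  have h := hasSum_strongSum_rightMul
    (fun e : {e : ShadowedEdge V // ω.shadowLabel e = k} => GraphGroupoid.ofEdge e.1)
    (fun _ => 1) 1 (2 * D) (by simp) ?_ ?_ ξ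
  · simp only [one_smul] at h
    exact h
  · rintro ⟨a⟩ F hF
    rw [← Finset.card_map (Function.Embedding.subtype _)]
    refine (card_le_of_left (V := V) a (hdeg a) _).1 ?_
    intro e he
    obtain ⟨e', he', rfl⟩ := Finset.mem_map.1 he
    have := hF e' he'
    injection this
  · rintro ⟨a⟩ F hF
    rw [← Finset.card_map (Function.Embedding.subtype _)]
    refine (card_le_of_left (V := V) a (hdeg a) _).2 ?_
    intro e he
    obtain ⟨e', he', rfl⟩ := Finset.mem_map.1 he
    have := hF e' he'
    injection this

/-- The labeling operator `T_G = ∑_{k = -N}^{-1} T_k + ∑_{j = 1}^{N} T_j`. -/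
def labelingOperator (ω : CanonicalWeighting V) : RightGraphAlg V :=
  ∑ k ∈ Finset.Icc (-(maxOutDegree V : ℤ)) (-1), labelingOperatorAt ω k +
    ∑ j ∈ Finset.Icc (1 : ℤ) (maxOutDegree V), labelingOperatorAt ω j

/-! ### The words and coefficients of the cumulant formula -/

/-- The word `e_1 ⋯ e_n` is a path in the shadowed graph. -/
def IsShadowedPath {n : ℕ} (w : Fin n → ShadowedEdge V) : Prop :=
  ∀ (j : ℕ) (h : j + 1 < n), (w ⟨j, Nat.lt_of_succ_lt h⟩).right = (w ⟨j + 1, h⟩).left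

/-- The paths `e_1 ⋯ e_n` with labels `l_{i_1}, …, l_{i_n}` of sum zero that are words in a single
pair `{e, e⁻¹}`. -/
def cumulantWordsAt (ω : CanonicalWeighting V) {n : ℕ} (i : Fin n → ℤ) :
    Set (Fin n → ShadowedEdge V) :=
  {w | IsShadowedPath w ∧ (∀ j, ω.shadowLabel (w j) = i j) ∧ ∑ j, i j = 0 ∧
    ∃ e : ShadowedEdge V, ∀ j, w j = e ∨ w j = e.inv}

/-- The union of the sets `cumulantWordsAt` over all `(i_1, …, i_n) ∈ {±1, …, ±N}^n`. -/
def cumulantWords (ω : CanonicalWeighting V) (n : ℕ) : Set (Fin n → ShadowedEdge V) :=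
  ⋃ i ∈ {i : Fin n → ℤ | ∀ j, 1 ≤ |i j| ∧ |i j| ≤ maxOutDegree V}, cumulantWordsAt ω i

/-- The operator `R_w` of a word `w = e_1 ⋯ e_n` in the edges of the shadowed graph. -/
def wordOperator {n : ℕ} (w : Fin n → ShadowedEdge V) : RightGraphAlg V :=
  rightMulOpt (GraphGroupoid.ofWord (List.ofFn w))

/-- The noncrossing partitions `π` with `E_π(R_{e_1}, …, R_{e_n}) = E(R_{e_n ⋯ e_1}) ≠ 0`. -/
def ncOfEdges {n : ℕ} (e : Fin n → ShadowedEdge V) : Set (NCPartition n) :=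
  {π | partitionMoment condExpDiag π (fun j => rightMulAlg (GraphGroupoid.ofEdge (e j))) =
      condExpDiag (wordOperator (e ∘ Fin.rev)) ∧
    condExpDiag (wordOperator (e ∘ Fin.rev)) ≠ 0}

open Classical in
/-- `μ_{(e_1, …, e_n)}`, the sum of `μ(π, 1_n)` over these partitions. -/
def muEdges {n : ℕ} (e : Fin n → ShadowedEdge V) : ℂ :=
  ∑ π : NCPartition n with π ∈ ncOfEdges e, π.moebius

/-- `μ_w = μ_{(e_1, …, e_n)}` for the word `w = e_n ⋯ e_1`. -/
def muWord {n : ℕ} (w : Fin n → ShadowedEdge V) : ℂ := muEdges (w ∘ Fin.rev)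

end Graph

end

/-!
The labeling operator is the strong sum of the `R_e` over all edges `e` of the shadowed graph, so the
cumulant `k_n(T_G, …, T_G)` is the sum of `k_n(R_{e_1}, …, R_{e_n})` over all words. The point is to
see which words contribute.

Let `p_i` be the product of the letters of `e_1, …, e_i` in the free group on the edges of the graph.
A product of edge operators along consecutive positions is `0` or some `R_x`; if the product of the
letters is `1`, then `x` is a vertex, and otherwise the expectation of `R_x` vanishes
(`condExpDiag_prod_edgeOperator`). By recursion, `E_π(R_{e_1}, …, R_{e_n})` is the full product
`R_{e_1} ⋯ R_{e_n}` if `π` is adapted to `p`, that is, if `p_a = p_b` whenever the positions from `a`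
to `b` (with `b` excluded) form a union of blocks of `π`, and it is `0` otherwise
(`coe_nestedMoment_eq_ite`). So `k_n(R_{e_1}, …, R_{e_n})` is `R_{e_1} ⋯ R_{e_n}` times the sum of
`μ(π, 1_n)` over the adapted `π`.

Colour a position by the underlying edge of its letter. If two colours occur, this sum vanishes
(`NCPartition.sum_moebius_isAdapted_eq_zero`), which is the vanishing of mixed cumulants. The adapted
partitions form an upper set `S`, and the claim is that the Möbius inverse `k` of the indicator
function of `S` vanishes at every `π` that has a block with two colours. This is shown by induction
on `π`. Cut such a block into its runs, the maximal monochromatic pieces. Splitting off a set of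
runs with trivial product leaves an element of `S` in `S` (`IsAdapted.inf_interval`), every
monochromatic element of `S` below `π` lies below one of these splittings
(`exists_sameRun_closed`), and there is such an element, since a trivial word in a free group can be
cancelled pair by pair (`IsAdapted.exists_le_isMonochromatic`). Inclusion and exclusion over the
runs then gives `k π = 0` (`eq_zero_of_forall_exists_split`).

The remaining words use a single pair `{e, e⁻¹}`; the product of their letters is `1` exactly if the
labels sum to zero, which forces even length. Only boundedly many such words start or end at a given
vertex, so their sum converges strongly, and it is enough to compare both sides on basis vectors.
There, `T_G` may be replaced by the sum over a large finite set of edges (`StabilizesTo`), and the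
multilinearity of the cumulant finishes the proof.
-/

noncomputable section

/-! ### Möbius inversion on an upper set -/

section MoebiusInversion

open Classical in
/-- If `k` sums to `1` below each element of `S`, and the meets of `π` with arbitrary subfamilies of `θ`
lie in `S`, then by inclusion and exclusion the sum of `k` over the elements below `π` that are below
no `θ i` is `0`, unless the family is empty. -/
theorem sum_filter_forall_not_le {L ι : Type*} [SemilatticeInf L] [OrderTop L] [Fintype L]
    {k : L → ℂ} {S : Set L} (hk : ∀ π ∈ S, ∑ σ with σ ≤ π, k σ = 1) (θ : ι → L) (Q : Finset ι) :
    ∀ π : L, (∀ A ⊆ Q, π ⊓ A.inf θ ∈ S) →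
      ∑ σ with σ ≤ π ∧ ∀ i ∈ Q, ¬σ ≤ θ i, k σ = if Q = ∅ then 1 else 0 := by
  induction Q using Finset.induction_on with
  | empty =>
    intro π h
    have := hk π (by simpa using h ∅ (by simp))
    simpa using this
  | insert i Q hi ih =>
    intro π h
    have h1 := ih π fun A hA => h A (hA.trans (Finset.subset_insert _ _))
    have h2 := ih (π ⊓ θ i) fun A hA => by
      have := h (insert i A) (Finset.insert_subset_insert _ hA)
      rwa [Finset.inf_insert, ← inf_assoc] at this
    have h3 := Finset.sum_filter_add_sum_filter_not
      (Finset.univ.filter fun σ => σ ≤ π ∧ ∀ j ∈ Q, ¬σ ≤ θ j) (fun σ => σ ≤ θ i) k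
    rw [Finset.filter_filter, Finset.filter_filter, h1] at h3
    have h4 : (Finset.univ.filter fun σ => (σ ≤ π ∧ ∀ j ∈ Q, ¬σ ≤ θ j) ∧ σ ≤ θ i) =
        Finset.univ.filter fun σ => σ ≤ π ⊓ θ i ∧ ∀ j ∈ Q, ¬σ ≤ θ j := by
      ext σ; simp only [Finset.mem_filter, Finset.mem_univ, true_and, le_inf_iff]; tauto
    have h5 : (Finset.univ.filter fun σ => (σ ≤ π ∧ ∀ j ∈ Q, ¬σ ≤ θ j) ∧ ¬σ ≤ θ i) =
        Finset.univ.filter fun σ => σ ≤ π ∧ ∀ j ∈ insert i Q, ¬σ ≤ θ j := by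
      ext σ; simp only [Finset.mem_filter, Finset.mem_univ, true_and, Finset.forall_mem_insert]
      tauto
    rw [h4, h5, h2] at h3
    rw [if_neg (Finset.insert_ne_empty i Q)]
    exact add_eq_left.1 h3

open Classical in
/-- Vanishing criterion for the Möbius inverse `k` of the indicator function of an upper set `S`. If each
`π` in `S` outside `M` is covered from below, as far as `S ∩ M` is concerned, by proper splittings
`π ⊓ θ i` whose meets stay in `S`, then `k` vanishes outside `M`. -/
theorem eq_zero_of_forall_exists_split {L ι : Type*} [SemilatticeInf L] [OrderTop L] [Fintype L]
    {k : L → ℂ} {S M : Set L} (hS : IsUpperSet S)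
    (hk : ∀ π, ∑ σ with σ ≤ π, k σ = if π ∈ S then 1 else 0)
    (hsplit : ∀ π ∈ S, π ∉ M → ∃ (Q : Finset ι) (θ : ι → L), Q.Nonempty ∧
      (∀ A ⊆ Q, π ⊓ A.inf θ ∈ S) ∧ (∀ i ∈ Q, ¬π ≤ θ i) ∧
      ∀ σ ∈ S, σ ∈ M → σ ≤ π → ∃ i ∈ Q, σ ≤ θ i) (π : L) (hπ : π ∉ M) : k π = 0 := by
  -- Outside the upper set `S` the function `k` vanishes, since all its sums there are zero.
  have key : ∀ π, π ∉ S → k π = 0 := by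
    intro π
    induction π using WellFoundedLT.induction with
    | ind π ih =>
      intro hπ
      have h := hk π
      rw [if_neg hπ, ← Finset.add_sum_erase _ _ (a := π) (by simp), Finset.sum_eq_zero, add_zero] at h
      · exact h
      · intro σ hσ
        simp only [Finset.mem_erase, Finset.mem_filter, Finset.mem_univ, true_and] at hσ
        exact ih σ (lt_of_le_of_ne hσ.2 hσ.1) fun h' => hπ (hS hσ.2 h')
  induction π using WellFoundedLT.induction with
  | ind π ih =>
    by_cases hπS : π ∈ S
    swap
    · exact key π hπS
    obtain ⟨Q, θ, hQ, hA, hlt, hcov⟩ := hsplit π hπS hπ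
    have h := sum_filter_forall_not_le (fun π hπ => by rw [hk, if_pos hπ]) θ Q π hA
    rw [if_neg hQ.ne_empty, Finset.sum_eq_single π] at h
    · exact h
    · intro σ hσ hne
      simp only [Finset.mem_filter, Finset.mem_univ, true_and] at hσ
      by_cases hσS : σ ∈ S
      swap
      · exact key σ hσS
      by_cases hσM : σ ∈ M
      · obtain ⟨i, hi, hle⟩ := hcov σ hσS hσM hσ.1
        exact absurd hle (hσ.2 i hi)
      · exact ih σ (lt_of_le_of_ne hσ.1 hne) hσM
    · intro h'
      simp only [Finset.mem_filter, Finset.mem_univ, true_and, le_refl] at h'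
      exact absurd hlt h'

open Classical in
/-- The function `σ ↦ ∑ ρ, μ(ρ, σ) h(ρ)` sums over the elements below `π` to `h π`. -/
theorem sum_filter_le_sum_mu {L : Type*} [PartialOrder L] [LocallyFiniteOrder L] [Fintype L]
    [DecidableEq L] (h : L → ℂ) (π : L) :
    ∑ σ with σ ≤ π, ∑ ρ, (IncidenceAlgebra.mu ℂ : IncidenceAlgebra ℂ L) ρ σ * h ρ = h π := by
  rw [Finset.sum_comm, Finset.sum_eq_single π]
  · rw [← Finset.sum_mul, Finset.sum_eq_single π]
    · simp
    · intro σ hσ hne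
      refine IncidenceAlgebra.apply_eq_zero_of_not_le (fun h' => hne ?_) _
      exact le_antisymm (Finset.mem_filter.1 hσ).2 h'
    · simp
  · intro ρ _ hne
    rw [← Finset.sum_mul]
    have h1 := IncidenceAlgebra.sum_Icc_mu_right (𝕜 := ℂ) ρ π
    rw [if_neg hne] at h1
    have h2 : ∑ σ with σ ≤ π, (IncidenceAlgebra.mu ℂ : IncidenceAlgebra ℂ L) ρ σ = 0 := by
      rw [← h1]
      symm
      refine Finset.sum_subset (fun σ hσ => ?_) fun σ hσ hσ' => ?_
      · simp [(Finset.mem_Icc.1 hσ).2]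
      · refine IncidenceAlgebra.apply_eq_zero_of_not_le (fun h' => hσ' ?_) _
        exact Finset.mem_Icc.2 ⟨h', (Finset.mem_filter.1 hσ).2⟩
    rw [h2, zero_mul]
  · simp

end MoebiusInversion

/-! ### Noncrossing partitions and partial products -/

section Noncrossing

namespace NCPartition

variable {n : ℕ}

instance : SemilatticeInf (NCPartition n) where
  inf π θ := ⟨π.1 ⊓ θ.1, fun i j k l hij hjk hkl hik hjl =>
    ⟨π.2 i j k l hij hjk hkl hik.1 hjl.1, θ.2 i j k l hij hjk hkl hik.2 hjl.2⟩⟩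
  inf_le_left π θ := show π.1 ⊓ θ.1 ≤ π.1 from inf_le_left
  inf_le_right π θ := show π.1 ⊓ θ.1 ≤ θ.1 from inf_le_right
  le_inf π θ ρ h1 h2 := show π.1 ≤ θ.1 ⊓ ρ.1 from le_inf h1 h2

instance : OrderTop (NCPartition n) where
  top := one n
  le_top π := show π.1 ≤ ⊤ from le_top

theorem SameBlock.left_lt {π : NCPartition n} {i j : ℕ} (h : π.SameBlock i j) : i < n := h.1

theorem SameBlock.right_lt {π : NCPartition n} {i j : ℕ} (h : π.SameBlock i j) : j < n := h.2.1

theorem SameBlock.refl (π : NCPartition n) {i : ℕ} (h : i < n) : π.SameBlock i i :=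
  ⟨h, h, π.1.refl' _⟩

theorem SameBlock.symm {π : NCPartition n} {i j : ℕ} (h : π.SameBlock i j) : π.SameBlock j i :=
  ⟨h.2.1, h.1, π.1.symm' h.2.2⟩

theorem SameBlock.trans {π : NCPartition n} {i j k : ℕ} (h : π.SameBlock i j)
    (h' : π.SameBlock j k) : π.SameBlock i k :=
  ⟨h.1, h'.2.1, π.1.trans' h.2.2 h'.2.2⟩

theorem SameBlock.of_crossing {π : NCPartition n} {i j k l : ℕ} (hik : π.SameBlock i k)
    (hjl : π.SameBlock j l) (hij : i < j) (hjk : j < k) (hkl : k < l) : π.SameBlock i j :=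
  ⟨hik.1, hjl.1, π.2 ⟨i, hik.1⟩ ⟨j, hjl.1⟩ ⟨k, hik.2.1⟩ ⟨l, hjl.2.1⟩ hij hjk hkl hik.2.2 hjl.2.2⟩

theorem sameBlock_inf {π θ : NCPartition n} {i j : ℕ} :
    (π ⊓ θ).SameBlock i j ↔ π.SameBlock i j ∧ θ.SameBlock i j :=
  ⟨fun ⟨hi, hj, h⟩ => ⟨⟨hi, hj, h.1⟩, ⟨hi, hj, h.2⟩⟩, fun ⟨⟨hi, hj, h⟩, ⟨_, _, h'⟩⟩ => ⟨hi, hj, h, h'⟩⟩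

theorem sameBlock_finset_inf {ι : Type*} (A : Finset ι) (θ : ι → NCPartition n) {i j : ℕ}
    (hi : i < n) (hj : j < n) :
    (A.inf θ).SameBlock i j ↔ ∀ a ∈ A, (θ a).SameBlock i j := by
  classical
  induction A using Finset.induction_on with
  | empty => exact ⟨fun _ a ha => by simp at ha, fun _ => ⟨hi, hj, trivial⟩⟩
  | insert a A _ ih => rw [Finset.inf_insert, sameBlock_inf, ih, Finset.forall_mem_insert]

theorem le_iff_sameBlock {π θ : NCPartition n} :
    π ≤ θ ↔ ∀ i j, π.SameBlock i j → θ.SameBlock i j :=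
  ⟨fun h _ _ ⟨hi, hj, hr⟩ => ⟨hi, hj, h hr⟩, fun h i j hr => (h i j ⟨i.2, j.2, hr⟩).2.2⟩

/-- The noncrossing partition into the positions of the interval `{x, …, y}` and all others. -/
def interval (n x y : ℕ) : NCPartition n :=
  ⟨⟨fun i j => (x ≤ i.1 ∧ i.1 ≤ y) ↔ (x ≤ j.1 ∧ j.1 ≤ y),
    ⟨fun _ => Iff.rfl, fun h => h.symm, fun h h' => h.trans h'⟩⟩, by
    rintro ⟨i, _⟩ ⟨j, _⟩ ⟨k, _⟩ ⟨l, _⟩ hij hjk hkl hik hjl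
    have h1 : (x ≤ i ∧ i ≤ y) ↔ (x ≤ k ∧ k ≤ y) := hik
    have h2 : (x ≤ j ∧ j ≤ y) ↔ (x ≤ l ∧ l ≤ y) := hjl
    change (x ≤ i ∧ i ≤ y) ↔ (x ≤ j ∧ j ≤ y)
    simp only [Fin.mk_lt_mk] at hij hjk hkl
    omega⟩

theorem sameBlock_interval {x y i j : ℕ} : (interval n x y).SameBlock i j ↔
    i < n ∧ j < n ∧ ((x ≤ i ∧ i ≤ y) ↔ (x ≤ j ∧ j ≤ y)) :=
  ⟨fun ⟨hi, hj, h⟩ => ⟨hi, hj, h⟩, fun ⟨hi, hj, h⟩ => ⟨hi, hj, h⟩⟩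

/-- The positions `a, …, b - 1` form a union of blocks of `π`. -/
def IsSaturated (π : NCPartition n) (a b : ℕ) : Prop :=
  ∀ i j, π.SameBlock i j → a ≤ i → i < b → a ≤ j ∧ j < b

theorem IsSaturated.mono {π θ : NCPartition n} (h : π ≤ θ) {a b : ℕ} (hθ : θ.IsSaturated a b) :
    π.IsSaturated a b :=
  fun i j hij => hθ i j (le_iff_sameBlock.1 h i j hij)

/-- A sequence `p` of partial products is adapted to `π` if `p a = p b` whenever the positions
`a, …, b - 1` form a union of blocks of `π`; in other words, `p` is constant on the blocks of the
Kreweras complement of `π`. -/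
def IsAdapted {X : Type*} (p : ℕ → X) (π : NCPartition n) : Prop :=
  ∀ a b, a ≤ b → b ≤ n → π.IsSaturated a b → p a = p b

theorem isUpperSet_isAdapted {X : Type*} (p : ℕ → X) :
    IsUpperSet {π : NCPartition n | π.IsAdapted p} :=
  fun _ _ h hπ a b hab hb hs => hπ a b hab hb (hs.mono h)

/-- A block that meets both `{x, …, y}` and its complement is the block of `x` and `y`. -/
theorem sameBlock_of_mem_interval {π : NCPartition n} {x y z z' : ℕ} (hxy : π.SameBlock x y)
    (hz : x ≤ z ∧ z ≤ y) (hz' : ¬(x ≤ z' ∧ z' ≤ y)) (h : π.SameBlock z z') : π.SameBlock x z := by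
  rcases hz.1.eq_or_lt with rfl | h1
  · exact SameBlock.refl π hxy.left_lt
  rcases hz.2.eq_or_lt with rfl | h2
  · exact hxy
  by_cases h3 : z' < x
  · exact (h.symm.of_crossing hxy h3 h1 h2).symm.trans h.symm
  · exact hxy.of_crossing h h1 h2 (by omega)

/-- If the product over `{x, …, y}` is trivial and `x`, `y` lie in one block, this block may be cut along
`{x, …, y}` without losing adaptedness. Without `x` and `y` in one block this fails: for
`π = {(1, 6), (2, 5), (3, 4), (7, 8)}` and a word `e e⁻¹ f f⁻¹ e e⁻¹ f f⁻¹`, cut along `{1, 2}`. -/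
theorem IsAdapted.inf_interval {X : Type*} {p : ℕ → X} {π : NCPartition n} (h : π.IsAdapted p)
    {x y : ℕ} (hle : x ≤ y) (hxy : π.SameBlock x y) (hp : p x = p (y + 1)) :
    (π ⊓ interval n x y).IsAdapted p := by
  intro a b hab hb hs
  have hs' : ∀ i j, π.SameBlock i j → ((x ≤ i ∧ i ≤ y) ↔ (x ≤ j ∧ j ≤ y)) → a ≤ i → i < b →
      a ≤ j ∧ j < b := fun i j hij hi =>
    hs i j (sameBlock_inf.2 ⟨hij, sameBlock_interval.2 ⟨hij.left_lt, hij.right_lt, hi⟩⟩)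
  have mix : ∀ z z', π.SameBlock z z' → (x ≤ z ∧ z ≤ y) → ¬(x ≤ z' ∧ z' ≤ y) →
      π.SameBlock x z := fun z z' hzz h1 h2 => sameBlock_of_mem_interval hxy h1 h2 hzz
  have hyn := hxy.right_lt
  by_cases hsat : π.IsSaturated a b
  · exact h a b hab hb hsat
  simp only [IsSaturated, not_forall] at hsat
  obtain ⟨u, w, huw, hau, hub, hw⟩ := hsat
  -- Only the block of `x` meets both `{x, …, y}` and its complement.
  have hout : ∀ z, ¬π.SameBlock x z → ∀ z', π.SameBlock z z' → a ≤ z → z < b →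
      (a ≤ z' ∧ z' < b) ∧ ((x ≤ z ∧ z ≤ y) ↔ (x ≤ z' ∧ z' ≤ y)) := by
    intro z hxz z' hzz h1 h2
    have hiff : (x ≤ z ∧ z ≤ y) ↔ (x ≤ z' ∧ z' ≤ y) := by
      constructor
      · intro h3; by_contra h4
        exact hxz (mix z z' hzz h3 h4)
      · intro h3; by_contra h4
        exact hxz ((mix z' z hzz.symm h3 h4).trans hzz.symm)
    exact ⟨hs' z z' hzz hiff h1 h2, hiff⟩
  by_cases hu : x ≤ u ∧ u ≤ y
  · by_cases hwI : x ≤ w ∧ w ≤ y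
    · exact absurd (hs' u w huw (iff_of_true hu hwI) hau hub) hw
    have hxu := mix u w huw hu hwI
    have hxw := hxu.trans huw
    have hx := hs' u x hxu.symm (iff_of_true hu ⟨le_refl x, hle⟩) hau hub
    have hy := hs' u y (hxu.symm.trans hxy) (iff_of_true hu ⟨hle, le_refl y⟩) hau hub
    have hnot : ∀ z, a ≤ z → z < b → ¬(x ≤ z ∧ z ≤ y) → ¬π.SameBlock x z := fun z h1 h2 h3 hxz =>
      hw (hs' z w (hxz.symm.trans hxw) (iff_of_false h3 hwI) h1 h2)
    have h1 : p a = p x := by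
      refine h a x hx.1 (by omega) fun z z' hzz h1 h2 => ?_
      have hxz := hnot z h1 (by omega) (by omega)
      obtain ⟨h3, h4⟩ := hout z hxz z' hzz h1 (by omega)
      refine ⟨h3.1, ?_⟩
      by_contra h5
      have h6 : x < z' := by omega
      by_cases h7 : w < z
      · exact hxz (hxw.trans (hxw.symm.of_crossing hzz h7 h2 h6))
      · exact hxz (hzz.of_crossing hxw h2 h6 (by omega)).symm
    have h2 : p (y + 1) = p b := by
      refine h (y + 1) b (by omega) hb fun z z' hzz h1 h2 => ?_
      have hxz := hnot z (by omega) h2 (by omega)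
      obtain ⟨h3, h4⟩ := hout z hxz z' hzz (by omega) h2
      refine ⟨?_, h3.2⟩
      by_contra h5
      have h6 : z' < x := by omega
      by_cases h7 : w < z'
      · exact hxz (hxw.trans (hxw.symm.of_crossing hzz.symm h7 h6 (by omega)) |>.trans hzz.symm)
      · exact hxz ((hzz.symm.of_crossing hxw h6 (by omega) (by omega)).symm.trans hzz.symm)
    rw [h1, hp, h2]
  · by_cases hwI : x ≤ w ∧ w ≤ y
    swap
    · exact absurd (hs' u w huw (iff_of_false hu hwI) hau hub) hw
    have hxw := mix w u huw.symm hwI hu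
    have hxu := hxw.trans huw.symm
    have hIn : ∀ z, (x ≤ z ∧ z ≤ y) → π.SameBlock x z → ¬(a ≤ z ∧ z < b) := fun z h1 hxz h2 =>
      hw (hs' z w (hxz.symm.trans hxw) (iff_of_true h1 hwI) h2.1 h2.2)
    have hOut : ∀ z, ¬(x ≤ z ∧ z ≤ y) → π.SameBlock x z → a ≤ z ∧ z < b := fun z h1 hxz =>
      hs' u z (hxu.symm.trans hxz) (iff_of_false hu h1) hau hub
    have hx := hIn x ⟨le_refl x, hle⟩ (SameBlock.refl π hxy.left_lt)
    have hy := hIn y ⟨hle, le_refl y⟩ hxy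
    -- A position outside `[a, b)` and `{x, …, y}` is not in the block of `x`, and its own block stays
    -- outside both.
    have hstay : ∀ z z', ¬(a ≤ z ∧ z < b) → ¬(x ≤ z ∧ z ≤ y) → π.SameBlock z z' →
        ¬(a ≤ z' ∧ z' < b) ∧ ¬(x ≤ z' ∧ z' ≤ y) ∧ ¬π.SameBlock x z := by
      intro z z' h1 h2 hzz
      have hxz : ¬π.SameBlock x z := fun hxz => h1 (hOut z h2 hxz)
      have h3 : ¬(x ≤ z' ∧ z' ≤ y) := fun h3 =>
        hxz ((mix z' z hzz.symm h3 h2).trans hzz.symm)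
      exact ⟨fun h4 => h1 (hs' z' z hzz.symm (iff_of_false h3 h2) h4.1 h4.2), h3, hxz⟩
    rcases lt_or_ge y a with hya | hya
    · have h1 : p (y + 1) = p a := by
        refine h (y + 1) a (by omega) (by omega) fun z z' hzz h1 h2 => ?_
        obtain ⟨h3, h4, hxz⟩ := hstay z z' (by omega) (by omega) hzz
        by_contra h5
        by_cases h6 : z' < x
        · exact hxz ((hzz.symm.of_crossing hxu h6 (by omega) (by omega)).symm.trans hzz.symm)
        · exact hxz (hxu.of_crossing hzz (by omega) (by omega) (by omega))
      have h2 : p x = p b := by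
        refine h x b (by omega) hb fun z z' hzz h1 h2 => ?_
        by_cases h3 : π.SameBlock x z
        · by_cases h4 : x ≤ z' ∧ z' ≤ y
          · omega
          · have := hOut z' h4 (h3.trans hzz); omega
        by_cases h4 : a ≤ z
        · have := hout z h3 z' hzz h4 h2
          omega
        by_cases h5 : z ≤ y
        · by_contra h6
          exact h3 (mix z z' hzz ⟨h1, h5⟩ (by omega))
        · obtain ⟨h6, h7, hxz⟩ := hstay z z' (by omega) (by omega) hzz
          by_contra h8
          by_cases h9 : z' < x
          · exact hxz ((hzz.symm.of_crossing hxu h9 (by omega) (by omega)).symm.trans hzz.symm)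
          · exact hxz (hxu.of_crossing hzz (by omega) (by omega) (by omega))
      rw [← h1, ← hp, h2]
    · have hbx : b ≤ x := by
        by_contra h1
        omega
      have h1 : p b = p x := by
        refine h b x hbx (by omega) fun z z' hzz h1 h2 => ?_
        obtain ⟨h3, h4, hxz⟩ := hstay z z' (by omega) (by omega) hzz
        by_contra h5
        by_cases h6 : z' < a
        · have hcr := hzz.symm.of_crossing (hxu.symm.trans hxy) (i := z') (j := u) (k := z) (l := y)
            (by omega) (by omega) (by omega)
          exact hxz (hxu.trans (hcr.symm.trans hzz.symm))
        · exact hxz (hxu.trans (hxu.symm.of_crossing hzz (by omega) h2 (by omega)))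
      have h2 : p a = p (y + 1) := by
        refine h a (y + 1) (by omega) (by omega) fun z z' hzz h1 h2 => ?_
        by_cases h3 : π.SameBlock x z
        · by_cases h4 : x ≤ z' ∧ z' ≤ y
          · omega
          · have := hOut z' h4 (h3.trans hzz); omega
        by_cases h4 : z < b
        · have := hout z h3 z' hzz h1 h4
          omega
        by_cases h5 : x ≤ z
        · by_contra h6
          exact h3 (mix z z' hzz ⟨h5, by omega⟩ (by omega))
        · obtain ⟨h6, h7, hxz⟩ := hstay z z' (by omega) (by omega) hzz
          by_contra h8
          by_cases h9 : z' < a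
          · have hcr := hzz.symm.of_crossing (hxu.symm.trans hxy) (i := z') (j := u) (k := z)
              (l := y) (by omega) (by omega) (by omega)
            exact hxz (hxu.trans (hcr.symm.trans hzz.symm))
          · exact hxz (hxu.trans (hxu.symm.of_crossing hzz (by omega) (by omega) (by omega)))
      rw [h2, ← hp, h1]

end NCPartition

end Noncrossing

/-! ### Runs of colours and vanishing of mixed coefficients -/

section FreeGroupWords

theorem FreeGroup.exists_adjacent_of_mk_eq_one {α : Type*} {L : List (α × Bool)}
    (h : FreeGroup.mk L = 1) (hL : L ≠ []) :
    ∃ L₁ L₂ x b, L = L₁ ++ (x, b) :: (x, !b) :: L₂ := by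
  have h1 : FreeGroup.mk L = FreeGroup.mk [] := h
  obtain ⟨M, h2, h3⟩ := FreeGroup.Red.exact.1 h1
  have h4 := FreeGroup.Red.nil_iff.1 h3
  subst h4
  rcases Relation.ReflTransGen.cases_head h2 with h5 | ⟨M, h5, _⟩
  · exact absurd h5 hL
  · cases h5
    exact ⟨_, _, _, _, rfl⟩

/-- The word that a block of an adapted partition spells is the quotient of the partial products at the
two ends of the block, as the gaps contribute nothing. -/
theorem mul_mk_map_of_isChain {α : Type*} {ℓ : ℕ → α × Bool} {p : ℕ → FreeGroup α}
    (hp : ∀ i, p (i + 1) = p i * FreeGroup.mk [ℓ i]) :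
    ∀ (L : List ℕ) (hL : L ≠ []), L.IsChain (fun x y => p (x + 1) = p y) →
      p (L.head hL) * FreeGroup.mk (L.map ℓ) = p (L.getLast hL + 1)
  | [x], _, _ => by simp [hp]
  | x :: y :: L, _, h => by
    rw [List.isChain_cons_cons] at h
    have ih := mul_mk_map_of_isChain hp (y :: L) (by simp) h.2
    have h1 : FreeGroup.mk ((x :: y :: L).map ℓ) =
        FreeGroup.mk [ℓ x] * FreeGroup.mk ((y :: L).map ℓ) := by
      rw [FreeGroup.mul_mk]; rfl
    rw [h1, List.head_cons, ← mul_assoc, ← hp, h.1, List.getLast_cons (by simp)]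
    exact ih

end FreeGroupWords

namespace NCPartition

variable {n : ℕ}

theorem isSaturated_between {π : NCPartition n} {x y : ℕ} (hxy : π.SameBlock x y)
    (h : ∀ z, x < z → z < y → ¬π.SameBlock x z) : π.IsSaturated (x + 1) y := by
  intro z z' hzz h1 h2
  have hxz := h z (by omega) h2
  by_contra h3
  rcases lt_trichotomy z' x with h4 | rfl | h4
  · exact hxz ((hzz.symm.of_crossing hxy h4 (by omega) h2).symm.trans hzz.symm)
  · exact hxz hzz.symm
  rcases (show y ≤ z' by omega).eq_or_lt with rfl | h5
  · exact hxz (hxy.trans hzz.symm)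
  · exact hxz (hxy.of_crossing hzz (by omega) h2 h5)

theorem isSaturated_hull {π : NCPartition n} {x y : ℕ} (hxy : π.SameBlock x y)
    (h : ∀ z, π.SameBlock x z → x ≤ z ∧ z ≤ y) : π.IsSaturated x (y + 1) := by
  intro z z' hzz h1 h2
  by_cases hxz : π.SameBlock x z
  · have := h z' (hxz.trans hzz)
    omega
  have h3 : z ≠ x := fun h => hxz (by rw [h]; exact SameBlock.refl π hxy.left_lt)
  have h4 : z ≠ y := fun h => hxz (h ▸ hxy)
  by_contra h5
  by_cases h6 : z' < x
  · exact hxz ((hzz.symm.of_crossing hxy h6 (by omega) (by omega)).symm.trans hzz.symm)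
  · exact hxz (hxy.of_crossing hzz (by omega) (by omega) (by omega))

/-- The word spelled by a block of an adapted partition is trivial in the free group, so two
neighbouring positions of the block carry inverse letters. -/
theorem IsAdapted.exists_cancel {α : Type*} {ℓ : ℕ → α × Bool} {p : ℕ → FreeGroup α}
    (hp : ∀ i, p (i + 1) = p i * FreeGroup.mk [ℓ i]) {π : NCPartition n} (h : π.IsAdapted p)
    {i : ℕ} (hi : i < n) : ∃ x y, π.SameBlock i x ∧ π.SameBlock i y ∧ x < y ∧
      (∀ z, π.SameBlock i z → z ≤ x ∨ y ≤ z) ∧ (ℓ x).1 = (ℓ y).1 ∧ p x = p (y + 1) := by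
  classical
  let L := (List.range n).filter fun j => π.SameBlock i j
  have hmem : ∀ j, j ∈ L ↔ π.SameBlock i j := by
    intro j
    simp only [L, List.mem_filter, List.mem_range, decide_eq_true_eq, and_iff_right_iff_imp]
    exact fun h => h.right_lt
  have hsort : L.Pairwise (· < ·) := List.Pairwise.filter _ List.pairwise_lt_range
  have hne : L ≠ [] := List.ne_nil_of_mem ((hmem i).2 (SameBlock.refl π hi))
  have hchain : L.IsChain (fun x y => p (x + 1) = p y) := by
    rw [List.isChain_iff_getElem]
    intro m hm
    have hx := (hmem _).1 (List.getElem_mem (show m < L.length by omega))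
    have hy := (hmem _).1 (List.getElem_mem hm)
    have hlt : L[m] < L[m + 1] := List.pairwise_iff_getElem.1 hsort _ _ _ _ (by omega)
    refine h _ _ hlt hy.right_lt.le (isSaturated_between (hx.symm.trans hy) fun z h1 h2 h3 => ?_)
    obtain ⟨k, hk, rfl⟩ := List.getElem_of_mem ((hmem z).2 (hx.trans h3))
    rcases lt_trichotomy k m with h4 | rfl | h4
    · have : L[k] < L[m] := List.pairwise_iff_getElem.1 hsort _ _ _ _ h4
      omega
    · omega
    rcases (show m + 1 ≤ k by omega).eq_or_lt with rfl | h5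
    · omega
    · have : L[m + 1] < L[k] := List.pairwise_iff_getElem.1 hsort _ _ _ _ h5
      omega
  have hprod := mul_mk_map_of_isChain hp L hne hchain
  have hx := (hmem _).1 (List.head_mem hne)
  have hy := (hmem _).1 (List.getLast_mem hne)
  have hhull : ∀ z ∈ L, L.head hne ≤ z ∧ z ≤ L.getLast hne := by
    intro z hz
    obtain ⟨k, hk, rfl⟩ := List.getElem_of_mem hz
    rw [List.head_eq_getElem, List.getLast_eq_getElem]
    constructor
    · rcases Nat.eq_zero_or_pos k with rfl | h4
      · exact le_rfl
      · exact (List.pairwise_iff_getElem.1 hsort _ _ _ _ h4).le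
    · rcases (show k ≤ L.length - 1 by omega).eq_or_lt with rfl | h4
      · exact le_rfl
      · exact (List.pairwise_iff_getElem.1 hsort _ _ _ _ h4).le
  rw [← h _ _ ((hhull _ (List.head_mem hne)).2.trans (Nat.le_succ _)) hy.right_lt
    (isSaturated_hull (hx.symm.trans hy) fun z hz => hhull z ((hmem z).2 (hx.trans hz))),
    mul_eq_left] at hprod
  obtain ⟨L₁, L₂, a, b, hL⟩ := FreeGroup.exists_adjacent_of_mk_eq_one hprod (by simpa using hne)
  obtain ⟨L₃, L₄, h1, -, h2⟩ := List.map_eq_append_iff.1 hL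
  obtain ⟨x, L₅, rfl, h3, h4⟩ := List.map_eq_cons_iff.1 h2
  obtain ⟨y, L₆, rfl, h5, -⟩ := List.map_eq_cons_iff.1 h4
  rw [h1] at hsort hchain
  refine ⟨x, y, (hmem x).1 (by simp [h1]), (hmem y).1 (by simp [h1]), ?_, fun z hz => ?_,
    by rw [h3, h5], ?_⟩
  · exact List.rel_of_pairwise_cons (List.pairwise_append.1 hsort).2.1 (by simp)
  · have hz' := (hmem z).2 hz
    rw [h1] at hz'
    obtain ⟨-, h6, h7⟩ := List.pairwise_append.1 hsort
    rcases List.mem_append.1 hz' with h8 | h8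
    · exact Or.inl (h7 z h8 x (by simp)).le
    rcases List.mem_cons.1 h8 with rfl | h8
    · exact Or.inl le_rfl
    rcases List.mem_cons.1 h8 with rfl | h8
    · exact Or.inr le_rfl
    · exact Or.inr (List.rel_of_pairwise_cons (List.pairwise_cons.1 h6).2 h8).le
  · have hc := (List.isChain_cons_cons.1 (List.isChain_append.1 hchain).2.1).1
    rw [hp y, ← hc, hp x, h3, h5, mul_assoc, FreeGroup.mul_mk]
    have : FreeGroup.mk ([(a, b)] ++ [(a, !b)]) = 1 := by
      have := FreeGroup.Red.Step.not (L₁ := []) (L₂ := []) (x := a) (b := b)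
      exact Quot.sound this
    rw [this, mul_one]

/-- Every block of `π` carries a single value of the colouring `c`. -/
def IsMonochromatic {α : Type*} (c : ℕ → α) (π : NCPartition n) : Prop :=
  ∀ i j, π.SameBlock i j → c i = c j

/-- Below each adapted partition there is a monochromatic one: split off cancelling pairs until all
blocks have a single colour. -/
theorem IsAdapted.exists_le_isMonochromatic {α : Type*} {ℓ : ℕ → α × Bool} {p : ℕ → FreeGroup α}
    (hp : ∀ i, p (i + 1) = p i * FreeGroup.mk [ℓ i]) {π : NCPartition n} (h : π.IsAdapted p) :
    ∃ σ ≤ π, σ.IsAdapted p ∧ σ.IsMonochromatic fun i => (ℓ i).1 := by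
  induction π using WellFoundedLT.induction with
  | ind π ih =>
    by_cases hm : π.IsMonochromatic fun i => (ℓ i).1
    · exact ⟨π, le_rfl, h, hm⟩
    simp only [IsMonochromatic, not_forall] at hm
    obtain ⟨i, j, hij, hc⟩ := hm
    obtain ⟨x, y, hx, hy, hlt, hnext, hxy, hpxy⟩ := h.exists_cancel hp hij.left_lt
    -- The two cancelling positions have one colour, so they are not the whole block of `i`.
    have hout : ∃ z, π.SameBlock i z ∧ ¬(x ≤ z ∧ z ≤ y) := by
      by_contra hcon
      push Not at hcon
      have hcol : ∀ z, π.SameBlock i z → (ℓ z).1 = (ℓ x).1 := by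
        intro z hz
        have h1 := hcon z hz
        rcases hnext z hz with h2 | h2
        · rw [le_antisymm h2 h1.1]
        · rw [le_antisymm h1.2 h2, hxy]
      exact hc ((hcol i (SameBlock.refl π hij.left_lt)).trans (hcol j hij).symm)
    obtain ⟨z, hz, hzout⟩ := hout
    have hlt' : π ⊓ interval n x y < π := by
      refine lt_of_le_of_ne inf_le_left fun heq => hzout ?_
      have h1 := le_iff_sameBlock.1 (inf_eq_left.1 heq) x z (hx.symm.trans hz)
      exact (sameBlock_interval.1 h1).2.2.1 ⟨le_rfl, hlt.le⟩
    obtain ⟨σ, hσ, h1, h2⟩ := ih _ hlt' (h.inf_interval hlt.le (hx.symm.trans hy) hpxy)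
    exact ⟨σ, hσ.trans inf_le_left, h1, h2⟩

/-- The positions `u` and `z` lie in the same block of `π`, and the positions of this block between
them have the same colour: `u` and `z` belong to the same run of the block. -/
def SameRun {α : Type*} (c : ℕ → α) (π : NCPartition n) (u z : ℕ) : Prop :=
  π.SameBlock u z ∧ ∀ v, π.SameBlock u v → (u ≤ v ∧ v ≤ z ∨ z ≤ v ∧ v ≤ u) → c v = c u

section Runs

variable {α : Type*} {c : ℕ → α} {π : NCPartition n} {u z w : ℕ}

theorem SameRun.refl (h : u < n) : SameRun c π u u :=
  ⟨SameBlock.refl π h, fun v _ h => by rw [show v = u by omega]⟩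

theorem SameRun.color_eq (h : SameRun c π u z) : c z = c u :=
  h.2 z h.1 (by omega)

theorem SameRun.symm (h : SameRun c π u z) : SameRun c π z u :=
  ⟨h.1.symm, fun v hv h' => by rw [h.color_eq]; exact h.2 v (h.1.trans hv) (by omega)⟩

theorem SameRun.trans (h : SameRun c π u z) (h' : SameRun c π z w) : SameRun c π u w := by
  refine ⟨h.1.trans h'.1, fun v hv h1 => ?_⟩
  by_cases h2 : u ≤ v ∧ v ≤ z ∨ z ≤ v ∧ v ≤ u
  · exact h.2 v hv h2
  · rw [← h.color_eq]
    exact h'.2 v (h.1.symm.trans hv) (by omega)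

theorem SameRun.of_mem (h : SameRun c π u z) (hw : π.SameBlock u w)
    (hw' : u ≤ w ∧ w ≤ z ∨ z ≤ w ∧ w ≤ u) : SameRun c π u w :=
  ⟨hw, fun v hv h' => h.2 v hv (by omega)⟩

/-- `x` and `y` are the first and the last position of a run of a block of `π`. -/
def IsRun (c : ℕ → α) (π : NCPartition n) (x y : ℕ) : Prop :=
  x ≤ y ∧ π.SameBlock x y ∧ ∀ z, π.SameBlock x z → (SameRun c π x z ↔ x ≤ z ∧ z ≤ y)

theorem exists_isRun (c : ℕ → α) (π : NCPartition n) (h : u < n) :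
    ∃ x y, IsRun c π x y ∧ SameRun c π x u := by
  classical
  let F := (Finset.range n).filter fun z => SameRun c π u z
  have hmem : ∀ z, z ∈ F ↔ SameRun c π u z := by
    intro z
    simp only [F, Finset.mem_filter, Finset.mem_range, and_iff_right_iff_imp]
    exact fun h => h.1.right_lt
  have hF : F.Nonempty := ⟨u, (hmem u).2 (SameRun.refl h)⟩
  have hx := (hmem _).1 (F.min'_mem hF)
  have hy := (hmem _).1 (F.max'_mem hF)
  refine ⟨F.min' hF, F.max' hF, ⟨F.min'_le_max' hF, hx.1.symm.trans hy.1, fun z hz => ⟨fun h1 => ?_,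
    fun h1 => (hx.symm.trans hy).of_mem hz (Or.inl h1)⟩⟩, hx.symm⟩
  have h2 := (hmem z).2 (hx.trans h1)
  exact ⟨F.min'_le z h2, F.le_max' z h2⟩

theorem IsRun.eq_of_sameRun {x y x' y' : ℕ} (h : IsRun c π x y) (h' : IsRun c π x' y')
    (hr : SameRun c π x x') : x = x' ∧ y = y' := by
  have h1 := (h.2.2 x' hr.1).1 hr
  have h2 := (h'.2.2 x hr.symm.1).1 hr.symm
  have h3 := (h.2.2 y' (hr.1.trans h'.2.1)).1
    (hr.trans ((h'.2.2 y' h'.2.1).2 ⟨h'.1, le_rfl⟩))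
  have h4 := (h'.2.2 y (hr.symm.1.trans h.2.1)).1
    (hr.symm.trans ((h.2.2 y h.2.1).2 ⟨h.1, le_rfl⟩))
  omega

/-- In a monochromatic refinement `σ` of `π`, some run of a given block of `π` is a union of blocks
of `σ`: a run that lies between two positions of one block of `σ` in different runs, at minimal
distance. -/
theorem exists_sameRun_closed {σ : NCPartition n} (hσ : σ ≤ π) (hm : σ.IsMonochromatic c) {i : ℕ}
    (hi : i < n) : ∃ u, π.SameBlock i u ∧
      ∀ z z', SameRun c π u z → σ.SameBlock z z' → SameRun c π u z' := by
  classical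
  have hle := le_iff_sameBlock.1 hσ
  by_cases hex : ∃ d a, π.SameBlock i a ∧ σ.SameBlock a (a + d) ∧ ¬SameRun c π a (a + d)
  swap
  · push Not at hex
    refine ⟨i, SameBlock.refl π hi, fun z z' hz hzz => hz.trans ?_⟩
    rcases le_total z z' with h | h
    · have := hex (z' - z) z hz.1
      rw [Nat.add_sub_cancel' h] at this
      exact this hzz
    · have := hex (z - z') z' (hz.1.trans (hle _ _ hzz))
      rw [Nat.add_sub_cancel' h] at this
      exact (this hzz.symm).symm
  obtain ⟨a, ha, hab, hrun⟩ := Nat.find_spec hex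
  -- Here `a` and `a + d` have one colour but lie in different runs, so a run of another colour lies
  -- strictly between them.
  set d := Nat.find hex with hd
  have hmin : ∀ z z', π.SameBlock i z → σ.SameBlock z z' → z < z' + d → z' < z + d →
      SameRun c π z z' := by
    intro z z' hz hzz h1 h2
    by_contra h3
    rcases le_total z z' with h | h
    · refine Nat.find_min hex (m := z' - z) (by omega) ⟨z, hz, ?_⟩
      rw [Nat.add_sub_cancel' h]
      exact ⟨hzz, h3⟩
    · refine Nat.find_min hex (m := z - z') (by omega) ⟨z', hz.trans (hle _ _ hzz), ?_⟩
      rw [Nat.add_sub_cancel' h]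
      exact ⟨hzz.symm, fun h4 => h3 h4.symm⟩
  have hcab := hm _ _ hab
  have hu : ∃ u, π.SameBlock a u ∧ (a ≤ u ∧ u ≤ a + d ∨ a + d ≤ u ∧ u ≤ a) ∧ c u ≠ c a := by
    by_contra hcon
    push Not at hcon
    exact hrun ⟨hle _ _ hab, hcon⟩
  obtain ⟨u, hau, hu, hcu⟩ := hu
  have hbetween : ∀ z, SameRun c π u z → a < z ∧ z < a + d := by
    intro z hz
    have h1 : c a ≠ c u := hcu.symm
    constructor
    · by_contra h2
      exact h1 (hz.2 a hau.symm (by omega))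
    · by_contra h2
      exact h1 (hcab.trans (hz.2 (a + d) (hau.symm.trans (hle _ _ hab)) (by omega)))
  refine ⟨u, ha.trans hau, fun z z' hz hzz => hz.trans ?_⟩
  have h1 := hbetween z hz
  have hne : ¬σ.SameBlock a z := fun h => hcu (hz.color_eq.symm.trans (hm _ _ h).symm)
  have h2 : a < z' := by
    by_contra h2
    rcases (show z' ≤ a by omega).eq_or_lt with rfl | h3
    · exact hne hzz.symm
    · exact hne ((hzz.symm.of_crossing hab h3 h1.1 h1.2).symm.trans hzz.symm)
  have h3 : z' < a + d := by
    by_contra h3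
    rcases (show a + d ≤ z' by omega).eq_or_lt with rfl | h4
    · exact hne (hab.trans hzz.symm)
    · exact hne (hab.of_crossing hzz h1.1 h1.2 h4)
  exact hmin z z' (ha.trans (hau.trans hz.1)) hzz (by omega) (by omega)

/-- If a run of a block of `π` is a union of blocks of `σ ≤ π`, then so is the whole interval that it
spans. -/
theorem IsRun.le_interval {σ : NCPartition n} (hσ : σ ≤ π) {x y : ℕ} (h : IsRun c π x y)
    (hcl : ∀ z z', SameRun c π x z → σ.SameBlock z z' → SameRun c π x z') :
    σ ≤ interval n x y := by
  have hle := le_iff_sameBlock.1 hσ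
  have key : ∀ z z', σ.SameBlock z z' → (x ≤ z ∧ z ≤ y) → (x ≤ z' ∧ z' ≤ y) := by
    intro z z' hzz hz
    by_contra hz'
    have h1 := sameBlock_of_mem_interval h.2.1 hz hz' (hle _ _ hzz)
    have h2 := hcl z z' ((h.2.2 z h1).2 hz) hzz
    exact hz' ((h.2.2 z' h2.1).1 h2)
  exact le_iff_sameBlock.2 fun z z' hzz => sameBlock_interval.2
    ⟨hzz.left_lt, hzz.right_lt, key z z' hzz, key z' z hzz.symm⟩

end Runs

/-- Any set of runs of one block with trivial products can be split off. Different runs of a block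
span disjoint intervals, so the cuts can be made one after the other. -/
theorem IsAdapted.inf_interval_finset {X α : Type*} {p : ℕ → X} {c : ℕ → α} {π : NCPartition n}
    (h : π.IsAdapted p) {i : ℕ} (A : Finset (ℕ × ℕ))
    (hA : ∀ q ∈ A, IsRun c π q.1 q.2 ∧ π.SameBlock i q.1 ∧ p q.1 = p (q.2 + 1)) :
    (π ⊓ A.inf fun q => interval n q.1 q.2).IsAdapted p := by
  classical
  induction A using Finset.induction_on with
  | empty => simpa using h
  | insert q A hq ih =>
    have ih' := ih fun q' hq' => hA q' (Finset.mem_insert_of_mem hq')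
    obtain ⟨hrun, hi, hp⟩ := hA q (Finset.mem_insert_self q A)
    rw [Finset.inf_insert, inf_comm (interval n q.1 q.2), ← inf_assoc]
    refine ih'.inf_interval hrun.1 (sameBlock_inf.2 ⟨hrun.2.1,
      (sameBlock_finset_inf _ _ hrun.2.1.left_lt hrun.2.1.right_lt).2 fun q' hq' => ?_⟩) hp
    obtain ⟨hrun', hi', -⟩ := hA q' (Finset.mem_insert_of_mem hq')
    have hdisj : ∀ z, SameRun c π q.1 z → ¬(q'.1 ≤ z ∧ z ≤ q'.2) := by
      intro z hz h1
      have h2 := (hrun'.2.2 z (hi'.symm.trans (hi.trans hz.1))).2 h1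
      obtain ⟨h3, h4⟩ := hrun.eq_of_sameRun hrun' (hz.trans h2.symm)
      exact hq (by rwa [Prod.ext h3 h4])
    exact sameBlock_interval.2 ⟨hrun.2.1.left_lt, hrun.2.1.right_lt,
      iff_of_false (hdisj _ (SameRun.refl hrun.2.1.left_lt))
        (hdisj _ ((hrun.2.2 _ hrun.2.1).2 ⟨hrun.1, le_rfl⟩))⟩

open Classical in
/-- Vanishing of mixed cumulants in combinatorial form: if two letters of the word differ in colour, the
Möbius coefficients of the adapted partitions sum to zero. -/
theorem sum_moebius_isAdapted_eq_zero {α : Type*} {ℓ : ℕ → α × Bool} {p : ℕ → FreeGroup α}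
    (hp : ∀ i, p (i + 1) = p i * FreeGroup.mk [ℓ i]) {i j : ℕ} (hi : i < n) (hj : j < n)
    (hij : (ℓ i).1 ≠ (ℓ j).1) :
    ∑ π : NCPartition n with π.IsAdapted p, π.moebius = 0 := by
  let c : ℕ → α := fun i => (ℓ i).1
  let S : Set (NCPartition n) := {π | π.IsAdapted p}
  let M : Set (NCPartition n) := {π | π.IsMonochromatic c}
  let k : NCPartition n → ℂ := fun σ =>
    ∑ ρ, (IncidenceAlgebra.mu ℂ : IncidenceAlgebra ℂ (NCPartition n)) ρ σ * if ρ ∈ S then 1 else 0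
  have hk : ∀ π, ∑ σ with σ ≤ π, k σ = if π ∈ S then 1 else 0 :=
    fun π => sum_filter_le_sum_mu _ π
  have h0 : k (one n) = 0 := by
    refine eq_zero_of_forall_exists_split (ι := ℕ × ℕ) (S := S) (M := M) (isUpperSet_isAdapted p) hk
      (fun π hπ hπM => ?_) (one n) fun h => hij (h i j ⟨hi, hj, trivial⟩)
    change ¬π.IsMonochromatic c at hπM
    simp only [IsMonochromatic, not_forall] at hπM
    obtain ⟨a, b, hab, hc⟩ := hπM
    let Q : Finset (ℕ × ℕ) := (Finset.range n ×ˢ Finset.range n).filter fun q =>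
      IsRun c π q.1 q.2 ∧ π.SameBlock a q.1 ∧ p q.1 = p (q.2 + 1)
    have hcov : ∀ σ ∈ S, σ ∈ M → σ ≤ π → ∃ q ∈ Q, σ ≤ interval n q.1 q.2 := by
      intro σ hσS hσM hσ
      obtain ⟨u, hu, hcl⟩ := exists_sameRun_closed hσ hσM hab.left_lt
      obtain ⟨x, y, hxy, hxu⟩ := exists_isRun c π hu.right_lt
      have hle := hxy.le_interval hσ fun z z' hz hzz =>
        hxu.trans (hcl z z' (hxu.symm.trans hz) hzz)
      refine ⟨(x, y), Finset.mem_filter.2 ⟨Finset.mem_product.2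
        ⟨Finset.mem_range.2 hxy.2.1.left_lt, Finset.mem_range.2 hxy.2.1.right_lt⟩, hxy,
        hu.trans hxu.1.symm, ?_⟩, hle⟩
      refine hσS x (y + 1) (hxy.1.trans (Nat.le_succ y)) hxy.2.1.right_lt fun z z' hzz h1 h2 => ?_
      have := (sameBlock_interval.1 (le_iff_sameBlock.1 hle z z' hzz)).2.2
      omega
    refine ⟨Q, fun q => interval n q.1 q.2, ?_, fun A hA => ?_, fun q hq hle => ?_, hcov⟩
    · obtain ⟨σ, hσ, h1, h2⟩ := IsAdapted.exists_le_isMonochromatic hp hπ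
      obtain ⟨q, hq, -⟩ := hcov σ h1 h2 hσ
      exact ⟨q, hq⟩
    · exact IsAdapted.inf_interval_finset hπ A fun q hq => (Finset.mem_filter.1 (hA hq)).2
    · obtain ⟨-, hrun, ha, -⟩ := Finset.mem_filter.1 hq
      have hall : ∀ z, π.SameBlock a z → c z = c q.1 := by
        intro z hz
        have h1 := le_iff_sameBlock.1 hle q.1 z (ha.symm.trans hz)
        have h2 := (sameBlock_interval.1 h1).2.2.1 ⟨le_rfl, hrun.1⟩
        exact ((hrun.2.2 z (ha.symm.trans hz)).2 h2).color_eq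
      exact hc ((hall a (SameBlock.refl π hab.left_lt)).trans (hall b hab).symm)
  rw [← h0, Finset.sum_filter]
  exact Finset.sum_congr rfl fun π _ => by simp [moebius, S]

end NCPartition

/-! ### Nested moments -/

section NestedMoments

open Classical in
theorem lastInBlock_spec {r : ℕ → ℕ → Prop} {p q : ℕ} (h : p < q) :
    p ≤ lastInBlock r p q ∧ lastInBlock r p q < q ∧
      (lastInBlock r p q = p ∨ r p (lastInBlock r p q)) ∧
      ∀ k, lastInBlock r p q < k → k < q → ¬r p k := by
  unfold lastInBlock
  set F := (Finset.Ico p q).filter (r p) with hF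
  have hle : ∀ k ∈ F, k ≤ F.sup id := fun k hk => Finset.le_sup (f := id) hk
  have hk : ∀ k, max p (F.sup id) < k → k < q → ¬r p k := fun k h1 h2 h3 => by
    have := hle k (Finset.mem_filter.2 ⟨Finset.mem_Ico.2 ⟨by omega, h2⟩, h3⟩)
    omega
  rcases F.eq_empty_or_nonempty with h1 | h1
  · rw [h1] at hk ⊢
    simp only [Finset.sup_empty, bot_eq_zero', zero_le, sup_of_le_left] at hk ⊢
    exact ⟨le_rfl, h, Or.inl trivial, hk⟩
  · obtain ⟨m, hm, hm'⟩ := Finset.exists_mem_eq_sup F h1 id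
    rw [hm'] at hk ⊢
    obtain ⟨h2, h3⟩ := Finset.mem_filter.1 hm
    have h4 := Finset.mem_Ico.1 h2
    rw [id, max_eq_right h4.1] at hk ⊢
    exact ⟨h4.1, h4.2, Or.inr h3, hk⟩

theorem lastInBlock_eq {r : ℕ → ℕ → Prop} {p q l : ℕ} (h1 : p ≤ l) (h2 : l < q)
    (h3 : l = p ∨ r p l) (h4 : ∀ k, l < k → k < q → ¬r p k) : lastInBlock r p q = l := by
  obtain ⟨h5, h6, h7, h8⟩ := lastInBlock_spec (r := r) (h1.trans_lt h2)
  rcases lt_trichotomy (lastInBlock r p q) l with h | h | h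
  · rcases h3 with rfl | h3
    · omega
    · exact absurd h3 (h8 l h h2)
  · exact h
  · rcases h7 with h7 | h7
    · omega
    · exact absurd h7 (h4 _ h h6)

/-- The recursion scheme of `nestedMoment` (first predicate) and `blockProduct` (second). -/
theorem nestedMoment_induction (r : ℕ → ℕ → Prop) {P Q : ℕ → ℕ → Prop}
    (h1 : ∀ p q, q ≤ p → P p q)
    (h2 : ∀ p q, p < q → Q p q → P (lastInBlock r p q + 1) q → P p q)
    (h3 : ∀ i q, (∀ j, i < j → j < q → ¬r i j) → Q i q)
    (h4 : ∀ i j q, i < j → j < q → r i j → (∀ k, i < k → k < j → ¬r i k) → P (i + 1) j → Q j q →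
      Q i q) : (∀ p q, P p q) ∧ ∀ i q, Q i q := by
  classical
  have key : ∀ d p q, q - p ≤ d → P p q ∧ Q p q := by
    intro d
    induction d with
    | zero =>
      intro p q h
      exact ⟨h1 p q (by omega), h3 p q fun j _ _ => by omega⟩
    | succ d ih =>
      intro p q h
      have hQ : Q p q := by
        by_cases hex : ∃ j, p < j ∧ j < q ∧ r p j
        · obtain ⟨h5, h6, h7⟩ := Nat.find_spec hex
          refine h4 p _ q h5 h6 h7 (fun k hk1 hk2 hk3 => ?_) (ih _ _ (by omega)).1
            (ih _ _ (by omega)).2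
          exact Nat.find_min hex hk2 ⟨hk1, hk2.trans h6, hk3⟩
        · push Not at hex
          exact h3 p q hex
      refine ⟨?_, hQ⟩
      rcases lt_or_ge p q with hpq | hpq
      · have := (lastInBlock_spec (r := r) hpq).1
        exact h2 p q hpq hQ (ih _ _ (by omega)).1
      · exact h1 p q hpq
  exact ⟨fun p q => (key _ p q le_rfl).1, fun p q => (key _ p q le_rfl).2⟩

variable {A : Type*} [Semiring A] [Algebra ℂ A] {B : Subalgebra ℂ A}

theorem nestedMoment_of_le (E : A → B) (r : ℕ → ℕ → Prop) (a : ℕ → A) {p q : ℕ} (h : q ≤ p) :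
    nestedMoment E r a p q = 1 := by
  rw [nestedMoment, if_neg (by omega)]

theorem nestedMoment_of_lt (E : A → B) (r : ℕ → ℕ → Prop) (a : ℕ → A) {p q : ℕ} (h : p < q) :
    nestedMoment E r a p q =
      E (blockProduct E r a p q) * nestedMoment E r a (lastInBlock r p q + 1) q := by
  rw [nestedMoment, if_pos h]

theorem blockProduct_of_forall_not (E : A → B) (r : ℕ → ℕ → Prop) (a : ℕ → A) {i q : ℕ}
    (h : ∀ j, i < j → j < q → ¬r i j) : blockProduct E r a i q = a i := by
  rw [blockProduct, dif_neg]
  rintro ⟨j, h1, h2, h3⟩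
  exact h j h1 h2 h3

theorem blockProduct_of_next (E : A → B) (r : ℕ → ℕ → Prop) (a : ℕ → A) {i j q : ℕ}
    (h1 : i < j) (h2 : j < q) (h3 : r i j) (h4 : ∀ k, i < k → k < j → ¬r i k) :
    blockProduct E r a i q = a i * nestedMoment E r a (i + 1) j * blockProduct E r a j q := by
  classical
  have hex : ∃ j, i < j ∧ j < q ∧ r i j := ⟨j, h1, h2, h3⟩
  rw [blockProduct, dif_pos hex]
  have : Nat.find hex = j := by
    rw [Nat.find_eq_iff]
    exact ⟨⟨h1, h2, h3⟩, fun k hk hk' => h4 k hk'.1 hk hk'.2.2⟩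
  convert rfl <;> exact this.symm

theorem lastInBlock_of_next {n : ℕ} {π : NCPartition n} {i j q : ℕ} (h1 : i < j) (h2 : j < q)
    (h3 : π.SameBlock i j) :
    lastInBlock π.SameBlock i q = lastInBlock π.SameBlock j q := by
  obtain ⟨h5, h6, h7, h8⟩ := lastInBlock_spec (r := π.SameBlock) h2
  refine lastInBlock_eq (by omega) h6 (Or.inr ?_) fun k hk1 hk2 hk3 =>
    h8 k hk1 hk2 (h3.symm.trans hk3)
  rcases h7 with h7 | h7
  · rwa [h7]
  · exact h3.trans h7

/-- The ordered product `a x * a (x + 1) * ⋯ * a (y - 1)`. -/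
def prodIco {A : Type*} [Monoid A] (a : ℕ → A) (x y : ℕ) : A :=
  ((List.range' x (y - x)).map a).prod

theorem prodIco_of_le {A : Type*} [Monoid A] (a : ℕ → A) {x y : ℕ} (h : y ≤ x) :
    prodIco a x y = 1 := by
  rw [prodIco, Nat.sub_eq_zero_of_le h]; rfl

theorem prodIco_succ {A : Type*} [Monoid A] (a : ℕ → A) (x : ℕ) : prodIco a x (x + 1) = a x := by
  simp [prodIco]

theorem prodIco_mul {A : Type*} [Monoid A] (a : ℕ → A) {x y z : ℕ} (h : x ≤ y) (h' : y ≤ z) :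
    prodIco a x y * prodIco a y z = prodIco a x z := by
  rw [prodIco, prodIco, prodIco, ← List.prod_append, ← List.map_append]
  congr 2
  have := List.range'_append_1 (s := x) (m := y - x) (n := z - y)
  rw [show x + (y - x) = y by omega, show y - x + (z - y) = z - x by omega] at this
  exact this

open NCPartition

/-- `π` is adapted to `p` on the positions `x, …, y - 1`. -/
def AdaptedOn {X : Type*} {n : ℕ} (p : ℕ → X) (π : NCPartition n) (x y : ℕ) : Prop :=
  ∀ a b, x ≤ a → a ≤ b → b ≤ y → π.IsSaturated a b → p a = p b

open Classical in
/-- If `E` maps a product over consecutive positions to itself when the partial products `p` at its two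
ends agree, and to `0` otherwise, then each partition-dependent moment is the full product or `0`,
according to whether the partition is adapted to `p`. -/
theorem coe_nestedMoment_eq_ite {X : Type*} {n : ℕ} {E : A → B} (h0 : E 0 = 0)
    (π : NCPartition n) {a : ℕ → A} {p : ℕ → X}
    (hE : ∀ x y, x < y → y ≤ n →
      (E (prodIco a x y) : A) = if p x = p y then prodIco a x y else 0) :
    (nestedMoment E π.SameBlock a 0 n : A) = if π.IsAdapted p then prodIco a 0 n else 0 := by
  have key := nestedMoment_induction π.SameBlock
    (P := fun x y => y ≤ n → π.IsSaturated x y →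
      (nestedMoment E π.SameBlock a x y : A) = if AdaptedOn p π x y then prodIco a x y else 0)
    (Q := fun x y => x < y → y ≤ n →
      blockProduct E π.SameBlock a x y =
        if AdaptedOn p π (x + 1) (lastInBlock π.SameBlock x y) then
          prodIco a x (lastInBlock π.SameBlock x y + 1) else 0) ?_ ?_ ?_ ?_
  · rw [key.1 0 n le_rfl fun i j hij _ _ => ⟨Nat.zero_le _, hij.right_lt⟩]
    congr 1
    simp [AdaptedOn, IsAdapted]
  · intro x y hxy _ _
    rw [nestedMoment_of_le _ _ _ hxy, prodIco_of_le _ hxy, if_pos]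
    · rfl
    · intro a b h1 h2 h3 _
      rw [show a = b by omega]
  · intro x y hxy hQ hP hy hs
    obtain ⟨h1, h2, h3, h4⟩ := lastInBlock_spec (r := π.SameBlock) hxy
    have hQ := hQ hxy hy
    set l := lastInBlock π.SameBlock x y with hl
    have hxl : π.SameBlock x l := by
      rcases h3 with h3 | h3
      · rw [h3]; exact SameBlock.refl π (by omega)
      · exact h3
    have hs1 : π.IsSaturated x (l + 1) := isSaturated_hull hxl fun z hz => by
      have h5 := hs x z hz le_rfl hxy
      refine ⟨h5.1, ?_⟩
      by_contra h6
      exact h4 z (by omega) h5.2 hz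
    have hs2 : π.IsSaturated (l + 1) y := fun z z' hzz h5 h6 => by
      have h7 := hs z z' hzz (by omega) h6
      refine ⟨?_, h7.2⟩
      by_contra h8
      have := hs1 z' z hzz.symm h7.1 (by omega)
      omega
    rw [nestedMoment_of_lt _ _ _ hxy, Subalgebra.coe_mul, ← hl, hP hy hs2, hQ]
    have hiff : AdaptedOn p π x y ↔
        AdaptedOn p π (x + 1) l ∧ p x = p (l + 1) ∧ AdaptedOn p π (l + 1) y := by
      constructor
      · exact fun h => ⟨fun a b ha hab hb => h a b (by omega) hab (by omega),
          h x (l + 1) le_rfl (by omega) h2 hs1, fun a b ha hab hb => h a b (by omega) hab hb⟩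
      · rintro ⟨h5, h6, h7⟩ a b ha hab hb hsat
        rcases hab.eq_or_lt with rfl | hab'
        · rfl
        rcases ha.eq_or_lt with rfl | ha'
        · have h8 := hsat x l hxl le_rfl hab'
          rw [h6]
          refine h7 (l + 1) b le_rfl (by omega) hb fun z z' hzz h9 h10 => ?_
          have h11 := hsat z z' hzz (by omega) h10
          refine ⟨?_, h11.2⟩
          by_contra h12
          have := hs1 z' z hzz.symm h11.1 (by omega)
          omega
        · rcases lt_or_ge l a with h8 | h8
          · exact h7 a b h8 hab hb hsat
          · refine h5 a b ha' hab ?_ hsat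
            by_contra h9
            have := hsat l x hxl.symm h8 (by omega)
            omega
    by_cases c1 : AdaptedOn p π (x + 1) l
    · rw [if_pos c1, hE _ _ (by omega) (by omega)]
      by_cases c2 : p x = p (l + 1)
      · rw [if_pos c2]
        by_cases c3 : AdaptedOn p π (l + 1) y
        · rw [if_pos c3, if_pos (hiff.2 ⟨c1, c2, c3⟩), prodIco_mul _ (by omega) h2]
        · rw [if_neg c3, if_neg fun h => c3 (hiff.1 h).2.2, mul_zero]
      · rw [if_neg c2, if_neg fun h => c2 (hiff.1 h).2.1, zero_mul]
    · rw [if_neg c1, if_neg fun h => c1 (hiff.1 h).1, h0]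
      exact zero_mul _
  · intro x y hnext hxy _
    rw [blockProduct_of_forall_not _ _ _ hnext,
      lastInBlock_eq le_rfl hxy (Or.inl rfl) hnext, prodIco_succ, if_pos]
    intro a b h1 h2 h3 _
    omega
  · intro x z y hxz hzy hr hnext hP hQ hxy hy
    rw [blockProduct_of_next _ _ _ hxz hzy hr hnext, lastInBlock_of_next hxz hzy hr, hQ hzy hy,
      hP (by omega) (isSaturated_between hr hnext)]
    obtain ⟨h1, h2, h3, h4⟩ := lastInBlock_spec (r := π.SameBlock) hzy
    set l := lastInBlock π.SameBlock z y with hl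
    have hiff : AdaptedOn p π (x + 1) l ↔
        AdaptedOn p π (x + 1) z ∧ AdaptedOn p π (z + 1) l := by
      constructor
      · exact fun h => ⟨fun a b ha hab hb => h a b ha hab (by omega),
          fun a b ha hab hb => h a b (by omega) hab hb⟩
      · rintro ⟨h5, h6⟩ a b ha hab hb hsat
        rcases lt_or_ge z a with h7 | h7
        · exact h6 a b h7 hab hb hsat
        · refine h5 a b ha hab ?_ hsat
          by_contra h8
          have := hsat z x hr.symm h7 (by omega)
          omega
    by_cases c1 : AdaptedOn p π (x + 1) z
    · by_cases c2 : AdaptedOn p π (z + 1) l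
      · rw [if_pos c1, if_pos c2, if_pos (hiff.2 ⟨c1, c2⟩), ← prodIco_succ a x,
          prodIco_mul _ (by omega) (by omega), prodIco_mul _ (by omega) (by omega)]
      · rw [if_neg c2, if_neg fun h => c2 (hiff.1 h).2, mul_zero]
    · rw [if_neg c1, if_neg fun h => c1 (hiff.1 h).1, mul_zero, zero_mul]

/-- A nested moment depends only on the entries at its positions, and a block product only on those up
to the last position of the block. -/
theorem nestedMoment_congr_and_blockProduct_congr {n : ℕ} (E : A → B) (π : NCPartition n)
    {a a' : ℕ → A} :
    (∀ x y, (∀ i, x ≤ i → i < y → a i = a' i) →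
      nestedMoment E π.SameBlock a x y = nestedMoment E π.SameBlock a' x y) ∧
    ∀ x y, x < y → (∀ i, x ≤ i → i ≤ lastInBlock π.SameBlock x y → a i = a' i) →
      blockProduct E π.SameBlock a x y = blockProduct E π.SameBlock a' x y := by
  refine nestedMoment_induction π.SameBlock ?_ ?_ ?_ ?_
  · intro x y hxy _
    rw [nestedMoment_of_le _ _ _ hxy, nestedMoment_of_le _ _ _ hxy]
  · intro x y hxy hQ hP h
    obtain ⟨h1, h2, -, -⟩ := lastInBlock_spec (r := π.SameBlock) hxy
    rw [nestedMoment_of_lt _ _ _ hxy, nestedMoment_of_lt _ _ _ hxy,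
      hQ hxy fun i hi hi' => h i hi (by omega), hP fun i hi hi' => h i (by omega) hi']
  · intro x y hnext hxy h
    rw [blockProduct_of_forall_not _ _ _ hnext, blockProduct_of_forall_not _ _ _ hnext,
      h x le_rfl (lastInBlock_spec hxy).1]
  · intro x z y hxz hzy hr hnext hP hQ hxy h
    rw [lastInBlock_of_next hxz hzy hr] at h
    have h1 := (lastInBlock_spec (r := π.SameBlock) hzy).1
    rw [blockProduct_of_next _ _ _ hxz hzy hr hnext, blockProduct_of_next _ _ _ hxz hzy hr hnext,
      h x le_rfl (by omega), hP fun i hi hi' => h i (by omega) (by omega),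
      hQ hzy fun i hi hi' => h i (by omega) hi']

/-- Linearity in the entry at position `m`, provided that the position occurs. -/
theorem nestedMoment_linear_and_blockProduct_linear {n : ℕ} (E : A →ₗ[ℂ] B) (π : NCPartition n)
    {a a₁ a₂ : ℕ → A} {m : ℕ} {c₁ c₂ : ℂ} (h₁ : ∀ i, i ≠ m → a i = a₁ i)
    (h₂ : ∀ i, i ≠ m → a i = a₂ i) (hm : a m = c₁ • a₁ m + c₂ • a₂ m) :
    (∀ x y, x ≤ m → m < y → nestedMoment E π.SameBlock a x y =
      c₁ • nestedMoment E π.SameBlock a₁ x y + c₂ • nestedMoment E π.SameBlock a₂ x y) ∧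
    ∀ x y, x < y → x ≤ m → m ≤ lastInBlock π.SameBlock x y →
      blockProduct E π.SameBlock a x y =
        c₁ • blockProduct E π.SameBlock a₁ x y + c₂ • blockProduct E π.SameBlock a₂ x y := by
  have hN₁ := (nestedMoment_congr_and_blockProduct_congr (a := a) (a' := a₁) E π).1
  have hN₂ := (nestedMoment_congr_and_blockProduct_congr (a := a) (a' := a₂) E π).1
  have hB₁ := (nestedMoment_congr_and_blockProduct_congr (a := a) (a' := a₁) E π).2
  have hB₂ := (nestedMoment_congr_and_blockProduct_congr (a := a) (a' := a₂) E π).2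
  refine nestedMoment_induction π.SameBlock ?_ ?_ ?_ ?_
  · intro x y hxy h1 h2
    omega
  · intro x y hxy hQ hP h1 h2
    simp only [nestedMoment_of_lt _ _ _ hxy]
    set l := lastInBlock π.SameBlock x y with hl
    rcases le_or_gt m l with h3 | h3
    · rw [hQ hxy h1 h3, map_add, map_smul, map_smul, add_mul, smul_mul_assoc, smul_mul_assoc,
        ← hN₁ (l + 1) y fun i hi _ => h₁ i (by omega), ← hN₂ (l + 1) y fun i hi _ => h₂ i (by omega)]
    · rw [hP h3 h2, mul_add, mul_smul_comm, mul_smul_comm,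
        ← hB₁ x y hxy fun i _ hi => h₁ i (by omega), ← hB₂ x y hxy fun i _ hi => h₂ i (by omega)]
  · intro x y hnext hxy h1 h2
    rw [lastInBlock_eq le_rfl hxy (Or.inl rfl) hnext] at h2
    obtain rfl : x = m := le_antisymm h1 h2
    simp only [blockProduct_of_forall_not _ _ _ hnext, hm]
  · intro x z y hxz hzy hr hnext hP hQ hxy h1 h2
    rw [lastInBlock_of_next hxz hzy hr] at h2
    simp only [blockProduct_of_next _ _ _ hxz hzy hr hnext]
    rcases h1.eq_or_lt with rfl | h1
    · rw [← hN₁ _ _ fun i hi hi' => h₁ i (by omega), ← hN₂ _ _ fun i hi hi' => h₂ i (by omega),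
        ← hB₁ _ _ hzy fun i hi hi' => h₁ i (by omega), ← hB₂ _ _ hzy fun i hi hi' => h₂ i (by omega),
        hm]
      simp only [add_mul, smul_mul_assoc]
    rcases lt_or_ge m z with h3 | h3
    · rw [hP h1 h3, ← h₁ x (by omega), ← h₂ x (by omega),
        ← hB₁ _ _ hzy fun i hi hi' => h₁ i (by omega), ← hB₂ _ _ hzy fun i hi hi' => h₂ i (by omega)]
      simp only [Subalgebra.coe_add, Subalgebra.coe_smul, mul_add, add_mul, smul_mul_assoc,
        mul_smul_comm]
    · rw [hQ hzy h3 h2, ← h₁ x (by omega), ← h₂ x (by omega),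
        ← hN₁ _ _ fun i hi hi' => h₁ i (by omega), ← hN₂ _ _ fun i hi hi' => h₂ i (by omega)]
      simp only [mul_add, mul_smul_comm]

/-- The partition-dependent moment as a multilinear map. -/
def partitionMomentMultilinear {n : ℕ} (E : A →ₗ[ℂ] B) (π : NCPartition n) :
    MultilinearMap ℂ (fun _ : Fin n => A) B :=
  MultilinearMap.mk' (partitionMoment E π)
    (by
      intro a m x y
      have h := (nestedMoment_linear_and_blockProduct_linear E π (m := m) (c₁ := 1) (c₂ := 1)
        (a := fun i => if h : i < n then Function.update a m (x + y) ⟨i, h⟩ else 1)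
        (a₁ := fun i => if h : i < n then Function.update a m x ⟨i, h⟩ else 1)
        (a₂ := fun i => if h : i < n then Function.update a m y ⟨i, h⟩ else 1) ?_ ?_ ?_).1 0 n
        (Nat.zero_le _) m.2
      · rw [one_smul, one_smul] at h
        exact h
      · intro i hi
        split_ifs with h
        · have : (⟨i, h⟩ : Fin n) ≠ m := fun h' => hi (by rw [← h'])
          simp [this]
        · rfl
      · intro i hi
        split_ifs with h
        · have : (⟨i, h⟩ : Fin n) ≠ m := fun h' => hi (by rw [← h'])
          simp [this]
        · rfl
      · simp)
    (by
      intro a m c x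
      have h := (nestedMoment_linear_and_blockProduct_linear E π (m := m) (c₁ := c) (c₂ := 0)
        (a := fun i => if h : i < n then Function.update a m (c • x) ⟨i, h⟩ else 1)
        (a₁ := fun i => if h : i < n then Function.update a m x ⟨i, h⟩ else 1)
        (a₂ := fun i => if h : i < n then Function.update a m x ⟨i, h⟩ else 1) ?_ ?_ ?_).1 0 n
        (Nat.zero_le _) m.2
      · rw [zero_smul, add_zero] at h
        exact h
      · intro i hi
        split_ifs with h
        · have : (⟨i, h⟩ : Fin n) ≠ m := fun h' => hi (by rw [← h'])
          simp [this]
        · rfl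
      · intro i hi
        split_ifs with h
        · have : (⟨i, h⟩ : Fin n) ≠ m := fun h' => hi (by rw [← h'])
          simp [this]
        · rfl
      · simp)

end NestedMoments

/-! ### Right multiplication operators and the conditional expectation -/

section Operators

variable {V : Type u} [Quiver.{v} V]

open Classical in
theorem basisVec_apply (g h : GraphGroupoid V) : basisVec g h = if h = g then 1 else 0 := by
  rw [basisVec, lp.single_apply, Pi.single_apply]

theorem ext_basisVec {S T : GraphHilbert V →L[ℂ] GraphHilbert V}
    (h : ∀ g, S (basisVec g) = T (basisVec g)) : S = T := by
  classical
  refine lp.ext_continuousLinearMap (by norm_num) fun g => ?_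
  ext1
  simpa [basisVec] using h g

namespace GraphGroupoid

theorem mul_bind_mul (g h k : GraphGroupoid V) :
    (g.mul h).bind (fun x => x.mul k) = (h.mul k).bind g.mul := by
  obtain ⟨a, b, f⟩ := g
  obtain ⟨c, d, f'⟩ := h
  obtain ⟨x, y, f''⟩ := k
  by_cases h1 : b = c
  · subst h1
    by_cases h2 : d = x
    · subst h2
      simp [mul]
    · simp [mul, h2]
  · by_cases h2 : d = x
    · subst h2
      simp [mul, h1]
    · simp [mul, h1, h2]

theorem inv_mul_self (g : GraphGroupoid V) : mul g.inv g = some (unit g.right) := by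
  obtain ⟨a, b, f⟩ := g
  simp [mul, inv, unit]

theorem mul_unit (g : GraphGroupoid V) : mul g (unit g.right) = some g := by
  obtain ⟨a, b, f⟩ := g
  exact (dif_pos rfl).trans (by simp only [unit, eqToHom_refl, Category.comp_id])

theorem unit_mul_eq_some_iff {a : Quiver.FreeGroupoid V} {x k : GraphGroupoid V} :
    mul (unit a) x = some k ↔ a = x.left ∧ k = x := by
  obtain ⟨c, d, f⟩ := x
  by_cases h : a = c
  · subst h
    simp [mul, unit, eq_comm]
  · simp [mul, unit, h]

theorem mul_eq_none_of_ne {g h : GraphGroupoid V} (H : g.right ≠ h.left) : mul g h = none :=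
  dif_neg H

end GraphGroupoid

open GraphGroupoid

theorem rightMulOpt_basisVec (w : Option (GraphGroupoid V)) (g : GraphGroupoid V) :
    (rightMulOpt w).1 (basisVec g) = (w.bind g.mul).elim 0 basisVec := by
  rcases w with _ | w
  · rfl
  · exact rightMul_basisVec w g

theorem rightMulOpt_mul_rightMulOpt (w w' : Option (GraphGroupoid V)) :
    rightMulOpt w * rightMulOpt w' = rightMulOpt (w'.bind fun g => w.bind g.mul) := by
  refine Subtype.ext (ext_basisVec fun g => ?_)
  change (rightMulOpt w).1 ((rightMulOpt w').1 (basisVec g)) = _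
  rw [rightMulOpt_basisVec, rightMulOpt_basisVec]
  rcases w' with _ | h
  · exact map_zero _
  rcases w with _ | k
  · exact (zero_apply _)
  rw [Option.bind_some, Option.bind_some, Option.bind_some, ← mul_bind_mul]
  rcases g.mul h with _ | m
  · exact map_zero _
  · exact rightMul_basisVec k m

theorem rightMulAlg_mul_rightMulAlg (g h : GraphGroupoid V) :
    rightMulAlg g * rightMulAlg h = rightMulOpt (h.mul g) :=
  rightMulOpt_mul_rightMulOpt (some g) (some h)

/-- The diagonal part multiplies the coordinate at `g` by the diagonal coefficient at the end of `g`. -/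
theorem diagonalPart_apply (x : GraphHilbert V →L[ℂ] GraphHilbert V) (ξ : GraphHilbert V)
    (g : GraphGroupoid V) :
    diagonalPart x ξ g = x (basisVec (unit g.right)) (unit g.right) * ξ g := by
  classical
  have h1 := (lp.evalCLM ℂ (fun _ : GraphGroupoid V => ℂ) 2 g).hasSum (hasSum_diagonalPart x ξ)
  have h2 : HasSum (fun a : V => ((x (basisVec (vertex a)) (vertex a)) •
      rightMul (vertex a)) ξ g) (diagonalPart x ξ g) := h1
  have h3 := hasSum_single (f := fun a : V => ((x (basisVec (vertex a)) (vertex a)) •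
      rightMul (vertex a)) ξ g) g.right.as fun a ha => by
    have h0 : rightMul (vertex a) ξ g = 0 :=
      (rightMul_unit_apply _ ξ g).trans (if_neg fun h => ha (by rw [h]))
    exact (congrArg _ h0).trans (mul_zero _)
  have h4 : rightMul (vertex (show V from g.right.as)) ξ g = ξ g :=
    (rightMul_unit_apply g.right ξ g).trans (if_pos rfl)
  rw [h2.unique h3]
  exact congrArg (x (basisVec (unit g.right)) (unit g.right) * ·) h4

theorem condExpDiag_apply (x : RightGraphAlg V) (ξ : GraphHilbert V) (g : GraphGroupoid V) :
    (condExpDiag x).1.1 ξ g = x.1 (basisVec (unit g.right)) (unit g.right) * ξ g :=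
  diagonalPart_apply x.1 ξ g

theorem condExpDiag_basisVec (x : RightGraphAlg V) (g : GraphGroupoid V) :
    (condExpDiag x).1.1 (basisVec g) =
      x.1 (basisVec (unit g.right)) (unit g.right) • basisVec g := by
  classical
  ext h
  rw [condExpDiag_apply]
  change _ = _ * basisVec g h
  rw [basisVec_apply]
  split_ifs with hg
  · rw [hg]
  · simp

variable (V) in
/-- The canonical conditional expectation as a linear map. -/
def condExpLinear : RightGraphAlg V →ₗ[ℂ] diagonalSubalgebra V where
  toFun := condExpDiag
  map_add' x y := by
    refine Subtype.ext (Subtype.ext ?_)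
    ext ξ g
    change (condExpDiag (x + y)).1.1 ξ g = (condExpDiag x).1.1 ξ g + (condExpDiag y).1.1 ξ g
    rw [condExpDiag_apply, condExpDiag_apply, condExpDiag_apply, ← add_mul]
    rfl
  map_smul' c x := by
    refine Subtype.ext (Subtype.ext ?_)
    ext ξ g
    change (condExpDiag (c • x)).1.1 ξ g = c * (condExpDiag x).1.1 ξ g
    rw [condExpDiag_apply, condExpDiag_apply, ← mul_assoc]
    rfl

theorem condExpDiag_rightMulAlg_unit (a : Quiver.FreeGroupoid V) :
    (condExpDiag (rightMulAlg (unit a)) : RightGraphAlg V) = rightMulAlg (unit a) := by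
  classical
  refine Subtype.ext ?_
  ext ξ g
  rw [condExpDiag_apply]
  change rightMul (unit a) _ _ * _ = rightMul (unit a) ξ g
  rw [rightMul_unit_apply, rightMul_unit_apply, basisVec_apply, if_pos rfl]
  change (if g.right = a then (1 : ℂ) else 0) * _ = _
  simp

theorem condExpDiag_rightMulAlg_of_ne_unit (x : GraphGroupoid V) (hx : ∀ a, x ≠ unit a) :
    (condExpDiag (rightMulAlg x) : RightGraphAlg V) = 0 := by
  classical
  refine Subtype.ext ?_
  ext ξ g
  rw [condExpDiag_apply]
  change rightMul x (basisVec (unit g.right)) (unit g.right) * _ = 0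
  rw [rightMul_basisVec]
  rcases h : (unit g.right).mul x with _ | k
  · simp
  · obtain ⟨-, rfl⟩ := unit_mul_eq_some_iff.1 h
    rw [Option.elim_some, basisVec_apply, if_neg (hx g.right).symm, zero_mul]

/-- The underlying edge of an edge of the shadowed graph, and whether it is an original edge. -/
def ShadowedEdge.letter (e : ShadowedEdge V) : Quiver.Total V × Bool :=
  Sum.elim (fun f => (⟨e.left, e.right, f⟩, true)) (fun f => (⟨e.right, e.left, f⟩, false)) e.hom

theorem ShadowedEdge.letter_inv (e : ShadowedEdge V) :
    e.inv.letter = (e.letter.1, !e.letter.2) := by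
  obtain ⟨a, b, f | f⟩ := e <;> rfl

theorem ShadowedEdge.letter_injective :
    Function.Injective (ShadowedEdge.letter : ShadowedEdge V → _) := by
  rintro ⟨a, b, f⟩ ⟨a', b', f'⟩ h
  have h1 := congrArg Prod.fst h
  have h2 := congrArg Prod.snd h
  rcases f with f | f <;> rcases f' with f' | f'
  · change (⟨a, b, f⟩ : Quiver.Total V) = ⟨a', b', f'⟩ at h1
    cases h1
    rfl
  · change true = false at h2
    cases h2
  · change false = true at h2
    cases h2
  · change (⟨b, a, f⟩ : Quiver.Total V) = ⟨b', a', f'⟩ at h1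
    cases h1
    rfl

theorem ShadowedEdge.eq_or_eq_inv {e f : ShadowedEdge V} (h : e.letter.1 = f.letter.1) :
    f = e ∨ f = e.inv := by
  by_cases h' : f.letter.2 = e.letter.2
  · exact Or.inl (letter_injective (Prod.ext h.symm h'))
  · refine Or.inr (letter_injective ?_)
    rw [letter_inv]
    refine Prod.ext h.symm ?_
    revert h'
    rcases f.letter.2 <;> rcases e.letter.2 <;> simp

variable (V) in
/-- The functor from the free groupoid on the graph to the free group on its edges. -/
def edgeFunctor : Quiver.FreeGroupoid V ⥤ CategoryTheory.SingleObj (FreeGroup (Quiver.Total V)) :=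
  Quiver.FreeGroupoid.lift
    { obj := fun _ => CategoryTheory.SingleObj.star _
      map := fun {a b} f => (FreeGroup.of (⟨a, b, f⟩ : Quiver.Total V) : FreeGroup (Quiver.Total V)) }

/-- The image of a groupoid element in the free group on the edges. Composition in a one-object
category reverses products, as does `R_g R_h = R_{h g}`, so weights multiply in operator order. -/
def GraphGroupoid.weight (g : GraphGroupoid V) : FreeGroup (Quiver.Total V) :=
  (edgeFunctor V).map g.hom

theorem weight_unit (a : Quiver.FreeGroupoid V) : (unit a).weight = 1 :=
  (edgeFunctor V).map_id a

theorem weight_of_mul {g h k : GraphGroupoid V} (H : g.mul h = some k) :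
    k.weight = h.weight * g.weight := by
  obtain ⟨a, b, f⟩ := g
  obtain ⟨c, d, f'⟩ := h
  by_cases h1 : b = c
  · subst h1
    simp only [mul, dite_true, eqToHom_refl, Category.id_comp, Option.some.injEq] at H
    subst H
    exact (edgeFunctor V).map_comp f f'
  · simp [mul, h1] at H

theorem weight_ofEdge (e : ShadowedEdge V) : (ofEdge e).weight = FreeGroup.mk [e.letter] := by
  obtain ⟨a, b, f⟩ := e
  have h : (ofEdge ⟨a, b, f⟩ : GraphGroupoid V).weight =
      (Paths.lift (Quiver.Symmetrify.lift (V' := CategoryTheory.SingleObj (FreeGroup (Quiver.Total V)))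
        { obj := fun _ => CategoryTheory.SingleObj.star _
          map := fun {a b} f => (FreeGroup.of (⟨a, b, f⟩ : Quiver.Total V) :
            FreeGroup (Quiver.Total V)) })).map f.toPath := rfl
  rw [h, Paths.lift_toPath]
  rcases f with f | f
  · rfl
  · rfl

theorem ofEdge_inv (e : ShadowedEdge V) : ofEdge e.inv = (ofEdge e).inv := rfl

end Operators

/-! ### Products of edge operators -/

section Words

variable {V : Type u} [Quiver.{v} V]

open GraphGroupoid NCPartition

/-- The operator `R_e` of an edge of the shadowed graph. -/
abbrev edgeOperator (e : ShadowedEdge V) : RightGraphAlg V := rightMulAlg (ofEdge e)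

/-- The product in the free group of the letters of a list of edges. -/
def listWeight (l : List (ShadowedEdge V)) : FreeGroup (Quiver.Total V) :=
  FreeGroup.mk (l.map ShadowedEdge.letter)

theorem listWeight_cons (e : ShadowedEdge V) (l : List (ShadowedEdge V)) :
    listWeight (e :: l) = FreeGroup.mk [e.letter] * listWeight l := by
  rw [listWeight, listWeight, FreeGroup.mul_mk]; rfl

theorem prod_edgeOperator_eq (l : List (ShadowedEdge V)) (hl : l ≠ []) :
    (l.map edgeOperator).prod = 0 ∨
      ∃ x, (l.map edgeOperator).prod = rightMulAlg x ∧ x.weight = listWeight l := by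
  induction l with
  | nil => exact absurd rfl hl
  | cons e l ih =>
    rw [List.map_cons, List.prod_cons]
    rcases eq_or_ne l [] with rfl | hl'
    · exact Or.inr ⟨ofEdge e, by simp, weight_ofEdge e⟩
    rcases ih hl' with h | ⟨x, h, hx⟩
    · rw [h]
      exact Or.inl (mul_zero _)
    · rw [h, rightMulAlg_mul_rightMulAlg]
      rcases hk : x.mul (ofEdge e) with _ | k
      · exact Or.inl rfl
      · refine Or.inr ⟨k, rfl, ?_⟩
        rw [weight_of_mul hk, hx, weight_ofEdge, listWeight_cons]

theorem prod_edgeOperator_mul_unit (l : List (ShadowedEdge V)) (hl : l ≠ [])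
    (a : Quiver.FreeGroupoid V) :
    (l.map edgeOperator).prod * rightMulAlg (unit a) = 0 ∨
      (l.map edgeOperator).prod * rightMulAlg (unit a) = (l.map edgeOperator).prod := by
  rcases prod_edgeOperator_eq l hl with h | ⟨x, h, -⟩
  · rw [h]
    exact Or.inl (zero_mul _)
  · rw [h, rightMulAlg_mul_rightMulAlg]
    by_cases hx : a = x.left
    · rw [unit_mul_eq_some_iff.2 ⟨hx, rfl⟩]
      exact Or.inr rfl
    · rw [mul_eq_none_of_ne (by exact hx)]
      exact Or.inl rfl

theorem unit_mul_prod_edgeOperator (l : List (ShadowedEdge V)) (hl : l ≠ [])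
    (a : Quiver.FreeGroupoid V) :
    rightMulAlg (unit a) * (l.map edgeOperator).prod = 0 ∨
      rightMulAlg (unit a) * (l.map edgeOperator).prod = (l.map edgeOperator).prod := by
  rcases prod_edgeOperator_eq l hl with h | ⟨x, h, -⟩
  · rw [h]
    exact Or.inl (mul_zero _)
  · rw [h, rightMulAlg_mul_rightMulAlg]
    by_cases hx : x.right = a
    · rw [← hx, mul_unit]
      exact Or.inr rfl
    · rw [mul_eq_none_of_ne (by exact hx)]
      exact Or.inl rfl

theorem edgeOperator_mul_edgeOperator_inv (e : ShadowedEdge V) :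
    edgeOperator e * edgeOperator e.inv = rightMulAlg (unit (ofEdge e).right) := by
  rw [edgeOperator, edgeOperator, rightMulAlg_mul_rightMulAlg, ofEdge_inv, inv_mul_self]
  rfl

theorem prod_map_append_cons_cons {α M : Type*} [Monoid M] (f : α → M) (l₁ l₂ : List α) (x y : α) :
    ((l₁ ++ x :: y :: l₂).map f).prod = (l₁.map f).prod * (f x * f y) * (l₂.map f).prod := by
  simp [mul_assoc]

/-- If multiplication by `u` either kills or preserves the neighbouring products, then `u` can be dropped
from a product that does not vanish. -/
theorem prod_mul_mul_prod_cases {α M : Type*} [MonoidWithZero M] (f : α → M) (l₁ l₂ : List α) (u : M)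
    (h : l₁ ++ l₂ ≠ [])
    (h₁ : l₁ ≠ [] → (l₁.map f).prod * u = 0 ∨ (l₁.map f).prod * u = (l₁.map f).prod)
    (h₂ : l₂ ≠ [] → u * (l₂.map f).prod = 0 ∨ u * (l₂.map f).prod = (l₂.map f).prod) :
    (l₁.map f).prod * u * (l₂.map f).prod = 0 ∨
      (l₁.map f).prod * u * (l₂.map f).prod = ((l₁ ++ l₂).map f).prod := by
  rw [List.map_append, List.prod_append]
  by_cases h3 : l₁ = []
  · have h4 : l₂ ≠ [] := by
      rintro rfl
      exact h (by simp [h3])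
    rw [mul_assoc]
    rcases h₂ h4 with h5 | h5
    · exact Or.inl (by rw [h5, mul_zero])
    · exact Or.inr (by rw [h5])
  · rcases h₁ h3 with h5 | h5
    · exact Or.inl (by rw [h5, zero_mul])
    · exact Or.inr (by rw [h5])

/-- The functor to the free group is faithful, in the form needed here: if the letters multiply to `1`,
then adjacent inverse letters can be cancelled down to a single vertex. -/
theorem prod_edgeOperator_of_listWeight_eq_one (l : List (ShadowedEdge V)) (hl : l ≠ [])
    (hw : listWeight l = 1) :
    (l.map edgeOperator).prod = 0 ∨ ∃ a, (l.map edgeOperator).prod = rightMulAlg (unit a) := by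
  induction hn : l.length using Nat.strong_induction_on generalizing l with
  | _ n ih =>
    obtain ⟨L₁, L₂, x, b, hL⟩ := FreeGroup.exists_adjacent_of_mk_eq_one hw (by simpa using hl)
    obtain ⟨l₁, l', rfl, hl₁, h'⟩ := List.map_eq_append_iff.1 hL
    obtain ⟨e, l'', rfl, he, h''⟩ := List.map_eq_cons_iff.1 h'
    obtain ⟨f, l₂, rfl, hf, hl₂⟩ := List.map_eq_cons_iff.1 h''
    have hfe : f = e.inv := ShadowedEdge.letter_injective (by
      rw [ShadowedEdge.letter_inv, hf, he])
    subst hfe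
    set a := (ofEdge e).right
    have hprod : ((l₁ ++ e :: e.inv :: l₂).map edgeOperator).prod =
        (l₁.map edgeOperator).prod * rightMulAlg (unit a) * (l₂.map edgeOperator).prod := by
      rw [prod_map_append_cons_cons, edgeOperator_mul_edgeOperator_inv]
    by_cases hnil : l₁ ++ l₂ = []
    · obtain ⟨rfl, rfl⟩ := List.append_eq_nil_iff.1 hnil
      refine Or.inr ⟨a, ?_⟩
      rw [hprod]
      simp
    have hw' : listWeight (l₁ ++ l₂) = 1 := by
      have h1 : listWeight (l₁ ++ l₂) = listWeight (l₁ ++ e :: e.inv :: l₂) := by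
        rw [listWeight, listWeight, hL, List.map_append, hl₁, hl₂]
        exact (Quot.sound FreeGroup.Red.Step.not).symm
      rw [h1, hw]
    have hih := ih (l₁ ++ l₂).length (by rw [← hn]; simp) (l₁ ++ l₂) hnil hw' rfl
    have hcase : ((l₁ ++ e :: e.inv :: l₂).map edgeOperator).prod = 0 ∨
        ((l₁ ++ e :: e.inv :: l₂).map edgeOperator).prod =
          ((l₁ ++ l₂).map edgeOperator).prod := by
      rw [hprod]
      exact prod_mul_mul_prod_cases edgeOperator l₁ l₂ _ hnil
        (fun h => prod_edgeOperator_mul_unit l₁ h a) fun h => unit_mul_prod_edgeOperator l₂ h a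
    rcases hcase with h | h
    · exact Or.inl h
    · rw [h]
      exact hih

theorem condExpDiag_zero : (condExpDiag (0 : RightGraphAlg V)) = 0 := map_zero (condExpLinear V)

open Classical in
theorem condExpDiag_prod_edgeOperator (l : List (ShadowedEdge V)) (hl : l ≠ []) :
    (condExpDiag (l.map edgeOperator).prod : RightGraphAlg V) =
      if listWeight l = 1 then (l.map edgeOperator).prod else 0 := by
  split_ifs with h
  · rcases prod_edgeOperator_of_listWeight_eq_one l hl h with h' | ⟨a, h'⟩
    · rw [h', condExpDiag_zero]
      rfl
    · rw [h', condExpDiag_rightMulAlg_unit]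
  · rcases prod_edgeOperator_eq l hl with h' | ⟨x, h', hx⟩
    · rw [h', condExpDiag_zero]
      rfl
    · rw [h', condExpDiag_rightMulAlg_of_ne_unit]
      rintro a rfl
      exact h (by rw [← hx, weight_unit])

theorem rightMulOpt_ofWord (l : List (ShadowedEdge V)) (hl : l ≠ []) :
    rightMulOpt (ofWord l) = (l.reverse.map edgeOperator).prod := by
  induction l with
  | nil => exact absurd rfl hl
  | cons e l ih =>
    rcases l with _ | ⟨f, l⟩
    · simp [ofWord, rightMulOpt]
    · rw [ofWord, List.reverse_cons, List.map_append, List.prod_append, ← ih (by simp)]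
      · simp only [List.map_cons, List.map_nil, List.prod_cons, List.prod_nil, mul_one]
        exact (rightMulOpt_mul_rightMulOpt (ofWord (f :: l)) (some (ofEdge e))).symm
      · simp

end Words

/-! ### Cumulants of edge operators -/

section WordCumulants

variable {V : Type u} [Quiver.{v} V]

open GraphGroupoid NCPartition

theorem listWeight_append (l l' : List (ShadowedEdge V)) :
    listWeight (l ++ l') = listWeight l * listWeight l' := by
  rw [listWeight, listWeight, listWeight, FreeGroup.mul_mk, List.map_append]

/-- A word `e_1 ⋯ e_n` as a sequence of edges, with the irrelevant value `e_1` from position `n` on. -/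
def edgeSeq {n : ℕ} (hn : 0 < n) (e : Fin n → ShadowedEdge V) (i : ℕ) : ShadowedEdge V :=
  if h : i < n then e ⟨i, h⟩ else e ⟨0, hn⟩

theorem map_edgeSeq_range {n : ℕ} (hn : 0 < n) (e : Fin n → ShadowedEdge V) :
    (List.range n).map (edgeSeq hn e) = List.ofFn e := by
  refine List.ext_getElem (by simp) fun i h1 h2 => ?_
  have h3 : i < n := by simpa using h1
  simp [edgeSeq, h3]

/-- The product of the letters of the first `i` edges of a word. -/
def partialWeight {n : ℕ} (hn : 0 < n) (e : Fin n → ShadowedEdge V) (i : ℕ) :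
    FreeGroup (Quiver.Total V) :=
  listWeight ((List.range i).map (edgeSeq hn e))

theorem partialWeight_succ {n : ℕ} (hn : 0 < n) (e : Fin n → ShadowedEdge V) (i : ℕ) :
    partialWeight hn e (i + 1) =
      partialWeight hn e i * FreeGroup.mk [(edgeSeq hn e i).letter] := by
  rw [partialWeight, partialWeight, List.range_succ, List.map_append, listWeight_append]
  rfl

theorem partialWeight_mul {n : ℕ} (hn : 0 < n) (e : Fin n → ShadowedEdge V) {x y : ℕ}
    (h : x ≤ y) : partialWeight hn e y =
      partialWeight hn e x * listWeight ((List.range' x (y - x)).map (edgeSeq hn e)) := by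
  have h1 := List.range'_append_1 (s := 0) (m := x) (n := y - x)
  rw [zero_add, Nat.add_sub_cancel' h] at h1
  rw [partialWeight, partialWeight, ← listWeight_append, ← List.map_append, List.range_eq_range',
    List.range_eq_range', h1]

/-- The operator `R_{e_1} ⋯ R_{e_n}`. -/
def wordProd {n : ℕ} (e : Fin n → ShadowedEdge V) : RightGraphAlg V :=
  ((List.ofFn e).map edgeOperator).prod

theorem wordOperator_rev {n : ℕ} (hn : 0 < n) (e : Fin n → ShadowedEdge V) :
    wordOperator (e ∘ Fin.rev) = wordProd e := by
  have h : (List.ofFn (e ∘ Fin.rev)).reverse = List.ofFn e := by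
    refine List.ext_getElem (by simp) fun i h1 h2 => ?_
    have h3 : i < n := by simpa using h2
    simp only [List.getElem_reverse, List.getElem_ofFn, Function.comp, List.length_ofFn]
    congr 1
    ext
    simp only [Fin.val_rev]
    omega
  rw [wordOperator, rightMulOpt_ofWord, h, wordProd]
  simpa using hn.ne'

open Classical in
theorem condExpDiag_wordProd {n : ℕ} (hn : 0 < n) (e : Fin n → ShadowedEdge V) :
    (condExpDiag (wordProd e) : RightGraphAlg V) =
      if listWeight (List.ofFn e) = 1 then wordProd e else 0 :=
  condExpDiag_prod_edgeOperator _ (by simpa using hn.ne')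

open Classical in
theorem partitionMoment_edgeOperator {n : ℕ} (hn : 0 < n) (e : Fin n → ShadowedEdge V)
    (π : NCPartition n) :
    (partitionMoment condExpDiag π (fun j => edgeOperator (e j))).1 =
      if π.IsAdapted (partialWeight hn e) then wordProd e else 0 := by
  have h1 : partitionMoment condExpDiag π (fun j => edgeOperator (e j)) =
      nestedMoment condExpDiag π.SameBlock (fun i => edgeOperator (edgeSeq hn e i)) 0 n := by
    refine (nestedMoment_congr_and_blockProduct_congr condExpDiag π).1 0 n fun i _ hi => ?_
    rw [dif_pos hi, edgeSeq, dif_pos hi]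
  have hprod : ∀ x y, prodIco (fun i => edgeOperator (edgeSeq hn e i)) x y =
      (((List.range' x (y - x)).map (edgeSeq hn e)).map edgeOperator).prod := by
    intro x y
    rw [prodIco, List.map_map]
    rfl
  have h2 : prodIco (fun i => edgeOperator (edgeSeq hn e i)) 0 n = wordProd e := by
    rw [hprod, Nat.sub_zero, ← List.range_eq_range', map_edgeSeq_range, wordProd]
  rw [h1, coe_nestedMoment_eq_ite condExpDiag_zero π (p := partialWeight hn e), h2]
  intro x y hxy hy
  rw [hprod, condExpDiag_prod_edgeOperator, partialWeight_mul hn e hxy.le]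
  · simp only [left_eq_mul]
  · have : y - x ≠ 0 := by omega
    simpa using this

theorem listWeight_ofFn_eq_one_of_isAdapted {n : ℕ} (hn : 0 < n) {e : Fin n → ShadowedEdge V}
    {π : NCPartition n} (h : π.IsAdapted (partialWeight hn e)) :
    listWeight (List.ofFn e) = 1 := by
  have h1 := h 0 n (Nat.zero_le n) le_rfl fun i j hij _ _ => ⟨Nat.zero_le _, hij.right_lt⟩
  rw [← map_edgeSeq_range hn e]
  exact h1.symm

open Classical in
theorem coe_sum_smul_eq {A ι : Type*} [Semiring A] [Algebra ℂ A] {B : Subalgebra ℂ A} [Fintype ι]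
    (c : ι → ℂ) (m : ι → B) (S : ι → Prop) (W : A) (h : ∀ i, (m i : A) = if S i then W else 0) :
    ((∑ i, c i • m i : B) : A) = (∑ i with S i, c i) • W := by
  rw [← Subalgebra.coe_val, map_sum, Finset.sum_smul, Finset.sum_filter]
  refine Finset.sum_congr rfl fun i _ => ?_
  rw [map_smul, Subalgebra.coe_val, h]
  split_ifs with hi
  · rfl
  · exact smul_zero _

open Classical in
theorem freeCumulant_edgeOperator {n : ℕ} (hn : 0 < n) (e : Fin n → ShadowedEdge V) :
    (freeCumulant condExpDiag (fun j => edgeOperator (e j))).1 =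
      (∑ π : NCPartition n with π.IsAdapted (partialWeight hn e), π.moebius) • wordProd e :=
  coe_sum_smul_eq _ _ _ _ (partitionMoment_edgeOperator hn e)

open Classical in
/-- If the expectation of the word is not zero, `E_π` equals it exactly for the adapted `π`. -/
theorem muEdges_eq {n : ℕ} (hn : 0 < n) (e : Fin n → ShadowedEdge V)
    (h : condExpDiag (wordProd e) ≠ 0) :
    muEdges e = ∑ π : NCPartition n with π.IsAdapted (partialWeight hn e), π.moebius := by
  rw [muEdges]
  refine Finset.sum_congr (Finset.filter_congr fun π _ => ?_) fun _ _ => rfl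
  have h' : (condExpDiag (wordProd e) : RightGraphAlg V) ≠ 0 := fun h1 => h (Subtype.ext h1)
  have hm := partitionMoment_edgeOperator hn e π
  rw [ncOfEdges, Set.mem_ofPred_eq, wordOperator_rev hn, and_iff_left h]
  constructor
  · intro h1
    by_contra h2
    rw [if_neg h2] at hm
    exact h' ((congrArg Subtype.val h1).symm.trans hm)
  · intro h1
    rw [if_pos h1] at hm
    refine Subtype.ext (hm.trans ?_)
    rw [condExpDiag_wordProd hn, if_pos (listWeight_ofFn_eq_one_of_isAdapted hn h1)]

theorem shadowLabel_inv (ω : CanonicalWeighting V) (e : ShadowedEdge V) :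
    ω.shadowLabel e.inv = -ω.shadowLabel e := by
  obtain ⟨a, b, f | f⟩ := e
  · rfl
  · exact (neg_neg _).symm

theorem abs_shadowLabel (ω : CanonicalWeighting V) (e : ShadowedEdge V) :
    |ω.shadowLabel e| = ω.label e.letter.1.hom := by
  obtain ⟨a, b, f | f⟩ := e
  · exact abs_of_nonneg (Int.natCast_nonneg _)
  · exact (abs_neg _).trans (abs_of_nonneg (Int.natCast_nonneg _))

theorem one_le_label (ω : CanonicalWeighting V) {a b : V} (f : a ⟶ b) : 1 ≤ ω.label f :=
  ((ω.bijOn a).1 (Set.mem_univ (⟨b, f⟩ : Quiver.Star a))).1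

theorem natCard_star_le {D : ℕ} {a : V} (h : ENat.card (Quiver.Star a) ≤ (D : ℕ∞)) :
    Nat.card (Quiver.Star a) ≤ D :=
  ENat.toNat_le_of_le_natCast h

theorem label_le (ω : CanonicalWeighting V) {D : ℕ}
    (hD : ∀ a : V, ENat.card (Quiver.Star a) ≤ (D : ℕ∞)) {a b : V} (f : a ⟶ b) :
    ω.label f ≤ maxOutDegree V := by
  refine ((ω.bijOn a).1 (Set.mem_univ (⟨b, f⟩ : Quiver.Star a))).2.trans ?_
  exact le_ciSup (f := fun a : V => Nat.card (Quiver.Star a))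
    ⟨D, by rintro _ ⟨a, rfl⟩; exact natCard_star_le (hD a)⟩ a

/-- The homomorphism that maps an edge to its label. -/
def labelHom (ω : CanonicalWeighting V) : FreeGroup (Quiver.Total V) →* Multiplicative ℤ :=
  FreeGroup.lift fun f => Multiplicative.ofAdd (ω.label f.hom : ℤ)

theorem labelHom_listWeight (ω : CanonicalWeighting V) (l : List (ShadowedEdge V)) :
    labelHom ω (listWeight l) = Multiplicative.ofAdd (l.map ω.shadowLabel).sum := by
  induction l with
  | nil => exact map_one _
  | cons e l ih =>
    rw [listWeight_cons, map_mul, ih, List.map_cons, List.sum_cons, ofAdd_add]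
    congr 1
    obtain ⟨a, b, f | f⟩ := e
    · exact FreeGroup.lift_mk.trans (by simp [ShadowedEdge.letter, CanonicalWeighting.shadowLabel])
    · exact FreeGroup.lift_mk.trans (by simp [ShadowedEdge.letter, CanonicalWeighting.shadowLabel])

theorem mk_letter_inv (e : ShadowedEdge V) :
    FreeGroup.mk [e.inv.letter] = (FreeGroup.mk [e.letter])⁻¹ := by
  rw [FreeGroup.inv_mk, ShadowedEdge.letter_inv]
  rfl

/-- A word in `e` and `e⁻¹` has the weight of a power `k` of the letter of `e`, its labels sum to `k`
times the label of `e`, and `k` has the parity of its length. -/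
theorem exists_zpow_of_forall_eq_or_eq_inv (ω : CanonicalWeighting V) (e : ShadowedEdge V)
    (l : List (ShadowedEdge V)) (h : ∀ f ∈ l, f = e ∨ f = e.inv) :
    ∃ k : ℤ, listWeight l = FreeGroup.mk [e.letter] ^ k ∧
      (l.map ω.shadowLabel).sum = k * ω.shadowLabel e ∧ (2 : ℤ) ∣ k - l.length := by
  induction l with
  | nil => exact ⟨0, by simp [listWeight, FreeGroup.one_eq_mk], by simp, by simp⟩
  | cons f l ih =>
    obtain ⟨k, hk, hk', hk2⟩ := ih fun f' hf' => h f' (List.mem_cons_of_mem _ hf')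
    rw [listWeight_cons, List.map_cons, List.sum_cons, hk, hk']
    rcases h f List.mem_cons_self with rfl | rfl
    · exact ⟨1 + k, by rw [zpow_add, zpow_one], by ring, by
      rw [List.length_cons]; push_cast; omega⟩
    · exact ⟨-1 + k, by rw [zpow_add, zpow_neg_one, mk_letter_inv], by rw [shadowLabel_inv]; ring, by
      rw [List.length_cons]; push_cast; omega⟩

theorem shadowLabel_ne_zero (ω : CanonicalWeighting V) (e : ShadowedEdge V) :
    ω.shadowLabel e ≠ 0 := by
  rw [← abs_pos, abs_shadowLabel]
  exact_mod_cast one_le_label ω _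

theorem ofWord_eq_some {l : List (ShadowedEdge V)} {x : GraphGroupoid V} (h : ofWord l = some x) :
    l.IsChain (fun e f => e.right = f.left) ∧ ∃ e l', l = e :: l' ∧ x.left = ⟨e.left⟩ := by
  induction l generalizing x with
  | nil => cases h
  | cons e l ih =>
    rcases l with _ | ⟨f, l⟩
    · refine ⟨List.isChain_singleton e, e, [], rfl, ?_⟩
      cases h
      rfl
    · rw [ofWord] at h
      · obtain ⟨y, hy, hxy⟩ := Option.bind_eq_some_iff.1 h
        obtain ⟨hc, f', l'', hfl, hyl⟩ := ih hy
        obtain ⟨rfl, rfl⟩ := List.cons_eq_cons.1 hfl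
        by_cases hef : (ofEdge e).right = y.left
        · rw [mul, dif_pos hef] at hxy
          refine ⟨List.isChain_cons_cons.2 ⟨?_, hc⟩, e, _, rfl, ?_⟩
          · rw [hyl] at hef
            exact congrArg CategoryTheory.Quotient.as hef
          · cases hxy
            rfl
        · rw [mul_eq_none_of_ne hef] at hxy
          cases hxy
      · simp

theorem exists_ofWord_of_wordOperator_ne_zero {n : ℕ} {w : Fin n → ShadowedEdge V}
    (h : wordOperator w ≠ 0) : ∃ x, wordOperator w = rightMulAlg x ∧ ofWord (List.ofFn w) = some x := by
  rcases hx : ofWord (List.ofFn w) with _ | x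
  · exact absurd (by rw [wordOperator, hx]; rfl) h
  · exact ⟨x, by rw [wordOperator, hx]; rfl, rfl⟩

theorem isShadowedPath_of_wordOperator_ne_zero {n : ℕ} {w : Fin n → ShadowedEdge V}
    (h : wordOperator w ≠ 0) : IsShadowedPath w := by
  obtain ⟨x, -, hx⟩ := exists_ofWord_of_wordOperator_ne_zero h
  intro j hj
  have h1 := List.isChain_iff_getElem.1 (ofWord_eq_some hx).1 j (by simpa using hj)
  simpa using h1

theorem mem_cumulantWords_iff (ω : CanonicalWeighting V) {D : ℕ}
    (hD : ∀ a : V, ENat.card (Quiver.Star a) ≤ (D : ℕ∞)) {n : ℕ} (w : Fin n → ShadowedEdge V) :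
    w ∈ cumulantWords ω n ↔ IsShadowedPath w ∧ ∑ j, ω.shadowLabel (w j) = 0 ∧
      ∃ e : ShadowedEdge V, ∀ j, w j = e ∨ w j = e.inv := by
  simp only [cumulantWords, cumulantWordsAt, Set.mem_iUnion, Set.mem_ofPred_eq, exists_prop]
  constructor
  · rintro ⟨i, -, h1, h2, h3, h4⟩
    exact ⟨h1, by simp only [h2, h3], h4⟩
  · rintro ⟨h1, h2, h3⟩
    refine ⟨fun j => ω.shadowLabel (w j), fun j => ?_, h1, fun _ => rfl, h2, h3⟩
    rw [abs_shadowLabel]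
    exact ⟨by exact_mod_cast one_le_label ω _, by exact_mod_cast label_le ω hD _⟩

theorem sum_shadowLabel_rev (ω : CanonicalWeighting V) {n : ℕ} (e : Fin n → ShadowedEdge V) :
    ∑ j, ω.shadowLabel ((e ∘ Fin.rev) j) = ((List.ofFn e).map ω.shadowLabel).sum := by
  rw [List.map_ofFn, List.sum_ofFn]
  exact Equiv.sum_comp Fin.revPerm fun j => ω.shadowLabel (e j)

theorem freeCumulant_edgeOperator_of_mem (ω : CanonicalWeighting V) {D : ℕ}
    (hD : ∀ a : V, ENat.card (Quiver.Star a) ≤ (D : ℕ∞)) {n : ℕ} (hn : 0 < n)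
    (e : Fin n → ShadowedEdge V) (h : e ∘ Fin.rev ∈ cumulantWords ω n) :
    (freeCumulant condExpDiag (fun j => edgeOperator (e j))).1 =
      muWord (e ∘ Fin.rev) • wordOperator (e ∘ Fin.rev) := by
  classical
  obtain ⟨-, h1, f, hf⟩ := (mem_cumulantWords_iff ω hD _).1 h
  rw [sum_shadowLabel_rev] at h1
  obtain ⟨k, hk, hk', -⟩ := exists_zpow_of_forall_eq_or_eq_inv ω f (List.ofFn e) (by
    intro g hg
    obtain ⟨j, rfl⟩ := (List.mem_ofFn' e g).1 hg
    simpa using hf j.rev)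
  rw [h1, zero_eq_mul, or_iff_left (shadowLabel_ne_zero ω f)] at hk'
  rw [hk', zpow_zero] at hk
  have hE := condExpDiag_wordProd hn e
  rw [if_pos hk] at hE
  have hrev : muWord (e ∘ Fin.rev) = muEdges e := by
    rw [muWord]
    congr 1
    ext1 j
    simp
  rw [freeCumulant_edgeOperator hn, wordOperator_rev hn, hrev]
  by_cases h0 : wordProd e = 0
  · rw [h0]
    exact (smul_zero _).trans (smul_zero _).symm
  · rw [muEdges_eq hn]
    intro h2
    exact h0 (by rw [← hE, h2]; rfl)

theorem freeCumulant_edgeOperator_of_notMem (ω : CanonicalWeighting V) {D : ℕ}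
    (hD : ∀ a : V, ENat.card (Quiver.Star a) ≤ (D : ℕ∞)) {n : ℕ} (hn : 0 < n)
    (e : Fin n → ShadowedEdge V) (h : e ∘ Fin.rev ∉ cumulantWords ω n) :
    (freeCumulant condExpDiag (fun j => edgeOperator (e j))).1 = 0 := by
  classical
  rw [freeCumulant_edgeOperator hn]
  by_cases h0 : wordProd e = 0
  · rw [h0]
    exact smul_zero _
  by_cases h1 : ∀ j, (e j).letter.1 = (e ⟨0, hn⟩).letter.1
  · by_cases h2 : ∃ π : NCPartition n, π.IsAdapted (partialWeight hn e)
    · obtain ⟨π, hπ⟩ := h2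
      refine absurd ((mem_cumulantWords_iff ω hD _).2 ⟨?_, ?_, e ⟨0, hn⟩, fun j => ?_⟩) h
      · refine isShadowedPath_of_wordOperator_ne_zero ?_
        rwa [wordOperator_rev hn]
      · rw [sum_shadowLabel_rev]
        have h3 := labelHom_listWeight ω (List.ofFn e)
        rw [listWeight_ofFn_eq_one_of_isAdapted hn hπ, map_one] at h3
        exact (Multiplicative.ofAdd.injective h3).symm
      · exact ShadowedEdge.eq_or_eq_inv (h1 j.rev).symm
    · push Not at h2
      rw [Finset.sum_eq_zero fun π hπ => absurd (Finset.mem_filter.1 hπ).2 (h2 π)]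
      exact zero_smul _ _
  · push Not at h1
    obtain ⟨j, hj⟩ := h1
    rw [sum_moebius_isAdapted_eq_zero (ℓ := fun i => (edgeSeq hn e i).letter)
      (partialWeight_succ hn e) j.2 hn]
    · exact zero_smul _ _
    · simpa [edgeSeq, hn] using hj

end WordCumulants

/-! ### Convergence -/

section Convergence

variable {V : Type u} [Quiver.{v} V]

open GraphGroupoid NCPartition Filter

variable (V) in
/-- The algebraic span of the basis vectors. -/
def finiteSpan : Submodule ℂ (GraphHilbert V) := Submodule.span ℂ (Set.range basisVec)

theorem basisVec_mem_finiteSpan (g : GraphGroupoid V) : basisVec g ∈ finiteSpan V :=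
  Submodule.subset_span ⟨g, rfl⟩

/-- On each finite linear combination of basis vectors the family `x` is eventually equal to `y`, and
`y` preserves these combinations. This is a strong form of strong convergence that is compatible with
products without a bound on the norms. -/
def StabilizesTo {ι : Type*} (l : Filter ι) (x : ι → RightGraphAlg V) (y : RightGraphAlg V) : Prop :=
  ∀ ξ ∈ finiteSpan V, y.1 ξ ∈ finiteSpan V ∧ ∀ᶠ i in l, (x i).1 ξ = y.1 ξ

variable {ι : Type*} {l : Filter ι} {x x' : ι → RightGraphAlg V} {y y' : RightGraphAlg V}

theorem StabilizesTo.of_basisVec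
    (h : ∀ g, y.1 (basisVec g) ∈ finiteSpan V ∧ ∀ᶠ i in l, (x i).1 (basisVec g) = y.1 (basisVec g)) :
    StabilizesTo l x y := by
  intro ξ hξ
  induction hξ using Submodule.span_induction with
  | mem ξ hξ =>
    obtain ⟨g, rfl⟩ := hξ
    exact h g
  | zero => simp
  | add ξ η _ _ hξ hη =>
    refine ⟨by rw [map_add]; exact add_mem hξ.1 hη.1, ?_⟩
    filter_upwards [hξ.2, hη.2] with i h1 h2
    rw [map_add, map_add, h1, h2]
  | smul c ξ _ hξ =>
    refine ⟨by rw [map_smul]; exact Submodule.smul_mem _ _ hξ.1, ?_⟩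
    filter_upwards [hξ.2] with i h1
    rw [map_smul, map_smul, h1]

theorem StabilizesTo.one : StabilizesTo l (fun _ => (1 : RightGraphAlg V)) 1 :=
  fun _ hξ => ⟨hξ, Eventually.of_forall fun _ => rfl⟩

theorem StabilizesTo.zero : StabilizesTo l (fun _ => (0 : RightGraphAlg V)) 0 :=
  fun _ _ => ⟨zero_mem _, Eventually.of_forall fun _ => rfl⟩

theorem StabilizesTo.mul (h : StabilizesTo l x y) (h' : StabilizesTo l x' y') :
    StabilizesTo l (fun i => x i * x' i) (y * y') := by
  intro ξ hξ
  obtain ⟨h1, h2⟩ := h' ξ hξ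
  obtain ⟨h3, h4⟩ := h _ h1
  refine ⟨h3, ?_⟩
  filter_upwards [h2, h4] with i h5 h6
  change (x i).1 ((x' i).1 ξ) = y.1 (y'.1 ξ)
  rw [h5, h6]

theorem StabilizesTo.add (h : StabilizesTo l x y) (h' : StabilizesTo l x' y') :
    StabilizesTo l (fun i => x i + x' i) (y + y') := by
  intro ξ hξ
  obtain ⟨h1, h2⟩ := h' ξ hξ
  obtain ⟨h3, h4⟩ := h ξ hξ
  refine ⟨add_mem h3 h1, ?_⟩
  filter_upwards [h2, h4] with i h5 h6
  change (x i).1 ξ + (x' i).1 ξ = y.1 ξ + y'.1 ξ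
  rw [h5, h6]

theorem StabilizesTo.smul (c : ℂ) (h : StabilizesTo l x y) :
    StabilizesTo l (fun i => c • x i) (c • y) := by
  intro ξ hξ
  obtain ⟨h3, h4⟩ := h ξ hξ
  refine ⟨Submodule.smul_mem _ c h3, ?_⟩
  filter_upwards [h4] with i h6
  change c • (x i).1 ξ = c • y.1 ξ
  rw [h6]

theorem StabilizesTo.sum {κ : Type*} (s : Finset κ) {x : κ → ι → RightGraphAlg V}
    {y : κ → RightGraphAlg V} (h : ∀ k ∈ s, StabilizesTo l (x k) (y k)) :
    StabilizesTo l (fun i => ∑ k ∈ s, x k i) (∑ k ∈ s, y k) := by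
  classical
  induction s using Finset.induction_on with
  | empty => simpa using StabilizesTo.zero
  | insert k s hk ih =>
    simp only [Finset.sum_insert hk]
    exact (h k (Finset.mem_insert_self k s)).add
      (ih fun k' hk' => h k' (Finset.mem_insert_of_mem hk'))

theorem StabilizesTo.condExp (h : StabilizesTo l x y) :
    StabilizesTo l (fun i => (condExpDiag (x i)).1) (condExpDiag y).1 := by
  refine StabilizesTo.of_basisVec fun g => ?_
  rw [condExpDiag_basisVec]
  refine ⟨Submodule.smul_mem _ _ (basisVec_mem_finiteSpan g), ?_⟩
  filter_upwards [(h _ (basisVec_mem_finiteSpan (unit g.right))).2] with i hi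
  rw [condExpDiag_basisVec, hi]

theorem StabilizesTo.moment (r : ℕ → ℕ → Prop) {a : ι → ℕ → RightGraphAlg V}
    {b : ℕ → RightGraphAlg V} (h : ∀ j, StabilizesTo l (fun i => a i j) (b j)) (p q : ℕ) :
    StabilizesTo l (fun i => (nestedMoment condExpDiag r (a i) p q).1)
      (nestedMoment condExpDiag r b p q).1 := by
  refine (nestedMoment_induction r
    (P := fun p q => StabilizesTo l (fun i => (nestedMoment condExpDiag r (a i) p q).1)
      (nestedMoment condExpDiag r b p q).1)
    (Q := fun p q => StabilizesTo l (fun i => blockProduct condExpDiag r (a i) p q)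
      (blockProduct condExpDiag r b p q)) ?_ ?_ ?_ ?_).1 p q
  · intro p q hpq
    simp only [nestedMoment_of_le _ _ _ hpq]
    exact StabilizesTo.one
  · intro p q hpq hQ hP
    simp only [nestedMoment_of_lt _ _ _ hpq]
    exact hQ.condExp.mul hP
  · intro p q hnext
    simp only [blockProduct_of_forall_not _ _ _ hnext]
    exact h p
  · intro p j q hpj hjq hr hnext hP hQ
    simp only [blockProduct_of_next _ _ _ hpj hjq hr hnext]
    exact ((h p).mul hP).mul hQ

/-- The operator-valued cumulant as a multilinear map. -/
def freeCumulantMultilinear {A : Type*} [Semiring A] [Algebra ℂ A] {B : Subalgebra ℂ A}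
    (E : A →ₗ[ℂ] B) (n : ℕ) : MultilinearMap ℂ (fun _ : Fin n => A) B :=
  ∑ π : NCPartition n, π.moebius • partitionMomentMultilinear E π

theorem freeCumulantMultilinear_apply {A : Type*} [Semiring A] [Algebra ℂ A] {B : Subalgebra ℂ A}
    (E : A →ₗ[ℂ] B) {n : ℕ} (a : Fin n → A) :
    freeCumulantMultilinear E n a = freeCumulant E a := by
  rw [freeCumulantMultilinear, freeCumulant, sum_apply]
  rfl

theorem StabilizesTo.cumulant {n : ℕ} (h : StabilizesTo l x y) :
    StabilizesTo l (fun i => (freeCumulant condExpDiag (fun _ : Fin n => x i)).1)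
      (freeCumulant condExpDiag (fun _ : Fin n => y)).1 := by
  have hcoe : ∀ z : RightGraphAlg V, (freeCumulant condExpDiag (fun _ : Fin n => z)).1 =
      ∑ π : NCPartition n, π.moebius •
        (partitionMoment condExpDiag π (fun _ : Fin n => z)).1 := by
    intro z
    rw [freeCumulant]
    exact map_sum (diagonalSubalgebra V).val _ _
  simp only [hcoe]
  refine StabilizesTo.sum _ fun π _ => StabilizesTo.smul _ (StabilizesTo.moment _ ?_ 0 n)
  intro j
  by_cases hj : j < n
  · simp only [dif_pos hj]
    exact h
  · simp only [dif_neg hj]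
    exact StabilizesTo.one

theorem finite_setOf_left_eq {D : ℕ} {a : V}
    (h : ENat.card (Quiver.Star a) ≤ (D : ℕ∞) ∧ ENat.card (Quiver.Costar a) ≤ (D : ℕ∞)) :
    {e : ShadowedEdge V | e.left = a}.Finite := by
  by_contra hinf
  obtain ⟨F, hF, hcard⟩ := Set.Infinite.exists_subset_card_eq hinf (2 * D + 1)
  have := (card_le_of_left a h F).1 fun e he => hF he
  omega

theorem edgeOperator_basisVec_of_ne {e : ShadowedEdge V} {g : GraphGroupoid V}
    (h : e.left ≠ g.right.as) : (edgeOperator e).1 (basisVec g) = 0 := by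
  have h1 : g.mul (ofEdge e) = none :=
    mul_eq_none_of_ne fun h' => h (congrArg CategoryTheory.Quotient.as h').symm
  exact (rightMul_basisVec _ _).trans (by rw [h1]; rfl)

theorem edgeOperator_basisVec_mem (e : ShadowedEdge V) (g : GraphGroupoid V) :
    (edgeOperator e).1 (basisVec g) ∈ finiteSpan V := by
  have h := rightMul_basisVec (ofEdge e) g
  change rightMul (ofEdge e) (basisVec g) ∈ _
  rw [h]
  rcases g.mul (ofEdge e) with _ | k
  · exact zero_mem _
  · exact basisVec_mem_finiteSpan k

theorem labelingOperatorAt_basisVec {D : ℕ} (hdeg : ∀ a : V,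
      ENat.card (Quiver.Star a) ≤ (D : ℕ∞) ∧ ENat.card (Quiver.Costar a) ≤ (D : ℕ∞))
    (ω : CanonicalWeighting V) (k : ℤ) (g : GraphGroupoid V) {F : Finset (ShadowedEdge V)}
    (hF : ∀ e : ShadowedEdge V, e.left = g.right.as → e ∈ F) :
    (labelingOperatorAt ω k).1 (basisVec g) =
      ∑ e ∈ F with ω.shadowLabel e = k, (edgeOperator e).1 (basisVec g) := by
  classical
  have h1 := hasSum_labelingOperatorAt hdeg ω k (basisVec g)
  have h2 := (hasSum_subtype_iff_indicator (s := {e | ω.shadowLabel e = k})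
    (f := fun e => (edgeOperator e).1 (basisVec g))).1 h1
  have h3 := hasSum_sum_of_ne_finset_zero (L := SummationFilter.unconditional _) (s := F)
    (f := Set.indicator {e | ω.shadowLabel e = k} fun e => (edgeOperator e).1 (basisVec g))
    fun e he => by
      rw [Set.indicator_apply]
      split_ifs
      · exact edgeOperator_basisVec_of_ne fun h => he (hF e h)
      · rfl
  rw [h2.unique h3, Finset.sum_filter]
  exact Finset.sum_congr rfl fun e _ => Set.indicator_apply _ _ _

theorem labelingOperator_basisVec {D : ℕ} (hdeg : ∀ a : V,
      ENat.card (Quiver.Star a) ≤ (D : ℕ∞) ∧ ENat.card (Quiver.Costar a) ≤ (D : ℕ∞))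
    (ω : CanonicalWeighting V) (g : GraphGroupoid V) {F : Finset (ShadowedEdge V)}
    (hF : ∀ e : ShadowedEdge V, e.left = g.right.as → e ∈ F) :
    (labelingOperator ω).1 (basisVec g) = ∑ e ∈ F, (edgeOperator e).1 (basisVec g) := by
  classical
  have hsum : ∀ s : Finset ℤ, (∑ k ∈ s, labelingOperatorAt ω k).1 (basisVec g) =
      ∑ e ∈ F with ω.shadowLabel e ∈ s, (edgeOperator e).1 (basisVec g) := by
    intro s
    rw [← Finset.sum_fiberwise_of_maps_to (t := s) (g := ω.shadowLabel)
      fun e he => (Finset.mem_filter.1 he).2]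
    have h1 : (∑ k ∈ s, labelingOperatorAt ω k).1 =
        ∑ k ∈ s, (labelingOperatorAt ω k).1 := map_sum (RightGraphAlg V).subtype _ _
    rw [h1, sum_apply]
    refine Finset.sum_congr rfl fun k hk => ?_
    rw [labelingOperatorAt_basisVec hdeg ω k g hF, Finset.filter_filter]
    refine Finset.sum_congr (Finset.filter_congr fun e _ => ?_) fun _ _ => rfl
    constructor
    · rintro rfl
      exact ⟨hk, rfl⟩
    · exact fun h => h.2
  change (∑ k ∈ Finset.Icc (-(maxOutDegree V : ℤ)) (-1), labelingOperatorAt ω k).1 (basisVec g) +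
    (∑ j ∈ Finset.Icc (1 : ℤ) (maxOutDegree V), labelingOperatorAt ω j).1 (basisVec g) = _
  rw [hsum, hsum, ← Finset.sum_filter_add_sum_filter_not F
    (fun e => ω.shadowLabel e ∈ Finset.Icc (-(maxOutDegree V : ℤ)) (-1))]
  congr 1
  refine Finset.sum_congr (Finset.filter_congr fun e _ => ?_) fun _ _ => rfl
  have h1 := abs_shadowLabel ω e
  have h2 := one_le_label ω e.letter.1.hom
  have h3 := label_le ω (fun a => (hdeg a).1) e.letter.1.hom
  rw [Finset.mem_Icc, Finset.mem_Icc]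
  rcases abs_cases (ω.shadowLabel e) with h4 | h4 <;> omega

theorem stabilizesTo_labelingOperator {D : ℕ} (hdeg : ∀ a : V,
      ENat.card (Quiver.Star a) ≤ (D : ℕ∞) ∧ ENat.card (Quiver.Costar a) ≤ (D : ℕ∞))
    (ω : CanonicalWeighting V) :
    StabilizesTo atTop (fun F : Finset (ShadowedEdge V) => ∑ e ∈ F, edgeOperator e)
      (labelingOperator ω) := by
  refine StabilizesTo.of_basisVec fun g => ?_
  have hfin := finite_setOf_left_eq (hdeg g.right.as)
  constructor
  · rw [labelingOperator_basisVec hdeg ω g (F := hfin.toFinset) fun e he => by simpa using he]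
    exact sum_mem fun e _ => edgeOperator_basisVec_mem e g
  · filter_upwards [eventually_ge_atTop hfin.toFinset] with F hF
    rw [labelingOperator_basisVec hdeg ω g (F := F) fun e he => hF (by simpa using he)]
    have h1 : (∑ e ∈ F, edgeOperator e).1 = ∑ e ∈ F, (edgeOperator e).1 :=
      map_sum (RightGraphAlg V).subtype _ _
    rw [h1, sum_apply]

theorem freeCumulant_sum_edgeOperator (n : ℕ) (F : Finset (ShadowedEdge V)) :
    freeCumulant condExpDiag (fun _ : Fin n => ∑ e ∈ F, edgeOperator e) =
      ∑ e ∈ Fintype.piFinset fun _ : Fin n => F,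
        freeCumulant condExpDiag fun j => edgeOperator (e j) := by
  classical
  have h := (freeCumulantMultilinear (condExpLinear V) n).map_sum_finset
    (fun _ e => edgeOperator e) (fun _ => F)
  simp only [freeCumulantMultilinear_apply] at h
  exact h

theorem ofWord_of_isChain (l : List (ShadowedEdge V)) (hl : l ≠ [])
    (hc : l.IsChain fun e f => e.right = f.left) :
    ∃ x, ofWord l = some x ∧ x.left = ⟨(l.head hl).left⟩ ∧ x.right = ⟨(l.getLast hl).right⟩ := by
  induction l with
  | nil => exact absurd rfl hl
  | cons e l ih =>
    rcases l with _ | ⟨f, l⟩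
    · exact ⟨ofEdge e, rfl, rfl, rfl⟩
    · rw [List.isChain_cons_cons] at hc
      obtain ⟨x, hx, h1, h2⟩ := ih (by simp) hc.2
      have h3 : (ofEdge e).right = x.left := by
        rw [h1, List.head_cons, ← hc.1]
        rfl
      refine ⟨⟨(ofEdge e).left, x.right, (ofEdge e).hom ≫ eqToHom h3 ≫ x.hom⟩, ?_, rfl, ?_⟩
      · rw [ofWord, hx, Option.bind_some, mul, dif_pos h3]
        simp
      · rw [List.getLast_cons (by simp)]
        exact h2

/-- A word in a single pair `{e, e⁻¹}` is determined by one of its letters and the positions at which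
this letter occurs. -/
theorem card_le_of_cumulantWords {D : ℕ} (hdeg : ∀ a : V,
      ENat.card (Quiver.Star a) ≤ (D : ℕ∞) ∧ ENat.card (Quiver.Costar a) ≤ (D : ℕ∞))
    (ω : CanonicalWeighting V) {n : ℕ} (F : Finset (cumulantWords ω n)) (j : Fin n) (a : V)
    (h : (∀ w ∈ F, (w.1 j).left = a) ∨ ∀ w ∈ F, (w.1 j).right = a) :
    F.card ≤ 2 ^ n * (2 * D) := by
  classical
  have himage : (F.image fun w => w.1 j).card ≤ 2 * D := by
    rcases h with h | h
    · refine (card_le_of_left a (hdeg a) _).1 fun e he => ?_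
      obtain ⟨w, hw, rfl⟩ := Finset.mem_image.1 he
      exact h w hw
    · refine (card_le_of_left a (hdeg a) _).2 fun e he => ?_
      obtain ⟨w, hw, rfl⟩ := Finset.mem_image.1 he
      exact h w hw
  refine (Finset.card_le_mul_card_image (f := fun w => w.1 j) F (2 ^ n) fun e _ => ?_).trans
    (Nat.mul_le_mul_left _ himage)
  have hcard : (Finset.univ : Finset (Fin n → Bool)).card = 2 ^ n := by simp
  rw [← hcard]
  refine Finset.card_le_card_of_injOn (fun w i => decide (w.1 i = e)) (by simp) ?_
  intro w hw w' hw' hww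
  have key : ∀ w : cumulantWords ω n, w.1 j = e → ∀ i, w.1 i = e ∨ w.1 i = e.inv := by
    intro w hwj i
    obtain ⟨-, -, f, hf⟩ := (mem_cumulantWords_iff ω (fun a => (hdeg a).1) w.1).1 w.2
    have hcol : ∀ i, (w.1 i).letter.1 = f.letter.1 := fun i => by
      rcases hf i with h | h
      · rw [h]
      · rw [h, ShadowedEdge.letter_inv]
    exact ShadowedEdge.eq_or_eq_inv (by rw [← hwj, hcol, hcol])
  simp only [Finset.coe_filter, Set.mem_ofPred_eq] at hw hw'
  refine Subtype.ext (funext fun i => ?_)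
  have h1 := congrFun hww i
  simp only [decide_eq_decide] at h1
  rcases key w hw.2 i with h2 | h2
  · rw [h2, h1.1 h2]
  · rcases key w' hw'.2 i with h3 | h3
    · rw [h3, h1.2 h3]
    · rw [h2, h3]

open Classical in
theorem norm_muEdges_le {n : ℕ} (e : Fin n → ShadowedEdge V) :
    ‖muEdges e‖ ≤ ∑ π : NCPartition n, ‖π.moebius‖ :=
  (norm_sum_le _ _).trans (Finset.sum_le_sum_of_subset_of_nonneg (Finset.filter_subset _ _)
    fun _ _ _ => norm_nonneg _)

/-- The words with letters in a large finite set exhaust all words. -/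
theorem tendsto_piFinset_atTop (α : Type*) (n : ℕ) :
    Tendsto (fun F : Finset α => Fintype.piFinset fun _ : Fin n => F) atTop atTop := by
  classical
  refine tendsto_atTop_finset_of_monotone (fun F F' h => Fintype.piFinset_subset _ _ fun _ => h)
    fun w => ⟨Finset.univ.image w, ?_⟩
  simp

theorem hasSum_freeCumulant_labelingOperator {D : ℕ} (hdeg : ∀ a : V,
      ENat.card (Quiver.Star a) ≤ (D : ℕ∞) ∧ ENat.card (Quiver.Costar a) ≤ (D : ℕ∞))
    (ω : CanonicalWeighting V) {n : ℕ} (hn : 0 < n) (ξ : GraphHilbert V) :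
    HasSum (fun w : cumulantWords ω n => muWord w.1 • (wordOperator w.1).1 ξ)
      ((freeCumulant condExpDiag (fun _ : Fin n => labelingOperator ω)).1.1 ξ) := by
  classical
  have hD := fun a => (hdeg a).1
  have hx : ∀ w : cumulantWords ω n, ∃ x : GraphGroupoid V, wordOperator w.1 = rightMulAlg x ∧
      x.left = ⟨(w.1 ⟨0, hn⟩).left⟩ ∧ x.right = ⟨(w.1 ⟨n - 1, by omega⟩).right⟩ := by
    intro w
    have hpath := ((mem_cumulantWords_iff ω hD w.1).1 w.2).1
    obtain ⟨x, hx, hl, hr⟩ := ofWord_of_isChain (List.ofFn w.1) (by simpa using hn.ne') (by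
      rw [List.isChain_iff_getElem]
      intro i hi
      simpa using hpath i (by simpa using hi))
    refine ⟨x, by rw [wordOperator, hx]; rfl, ?_, ?_⟩
    · rw [hl, List.head_ofFn]
    · rw [hr, List.getLast_ofFn]
  choose x hx hl hr using hx
  have hS := hasSum_strongSum_rightMul x (fun w => muWord w.1) (∑ π : NCPartition n, ‖π.moebius‖)
    (2 ^ n * (2 * D)) (fun w => norm_muEdges_le _)
    (fun a F hF => card_le_of_cumulantWords hdeg ω F ⟨0, hn⟩ a.as (Or.inl fun w hw => by
      rw [← hF w hw, hl]))
    (fun a F hF => card_le_of_cumulantWords hdeg ω F ⟨n - 1, by omega⟩ a.as (Or.inr fun w hw => by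
      rw [← hF w hw, hr]))
  set S := strongSum fun w => muWord w.1 • rightMul (x w)
  have hS' : ∀ ξ, HasSum (fun w : cumulantWords ω n => muWord w.1 • (wordOperator w.1).1 ξ) (S ξ) := by
    intro ξ
    convert hS ξ using 2 with w
    rw [hx w]
    rfl
  have hST : S = (freeCumulant condExpDiag (fun _ : Fin n => labelingOperator ω)).1.1 := by
    refine ext_basisVec fun g => ?_
    have h1 := (hasSum_subtype_iff_indicator (s := cumulantWords ω n)
      (f := fun w => muWord w • (wordOperator w).1 (basisVec g))).1 (hS' (basisVec g))
    have h2 := h1.comp (tendsto_piFinset_atTop (ShadowedEdge V) n)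
    have h3 := ((stabilizesTo_labelingOperator hdeg ω).cumulant (n := n) _
      (basisVec_mem_finiteSpan g)).2
    refine tendsto_nhds_unique h2 (tendsto_const_nhds.congr' ?_)
    filter_upwards [h3] with F hF
    rw [← hF, freeCumulant_sum_edgeOperator]
    have h4 : (∑ e ∈ Fintype.piFinset fun _ : Fin n => F,
        freeCumulant condExpDiag fun j => edgeOperator (e j)).1.1 =
        ∑ e ∈ Fintype.piFinset fun _ : Fin n => F,
          (freeCumulant condExpDiag fun j => edgeOperator (e j)).1.1 :=
      map_sum ((RightGraphAlg V).subtype.toAlgHom.comp (diagonalSubalgebra V).val) _ _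
    rw [h4, sum_apply]
    have hrev : ∀ e : Fin n → ShadowedEdge V, (e ∘ Fin.rev) ∘ Fin.rev = e := fun e => by
      ext1 j
      simp
    have hmem : ∀ e ∈ Fintype.piFinset fun _ : Fin n => F,
        e ∘ Fin.rev ∈ Fintype.piFinset fun _ : Fin n => F := fun e he =>
      Fintype.mem_piFinset.2 fun j => Fintype.mem_piFinset.1 he _
    refine Finset.sum_nbij' (fun e => e ∘ Fin.rev) (fun e => e ∘ Fin.rev) hmem hmem
      (fun e _ => hrev e) (fun e _ => hrev e) fun e _ => ?_
    rw [Set.indicator_apply]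
    split_ifs with h
    · rw [freeCumulant_edgeOperator_of_mem ω hD hn e h]
      rfl
    · rw [freeCumulant_edgeOperator_of_notMem ω hD hn e h]
      rfl
  rw [← hST]
  exact hS' ξ

theorem even_of_mem_cumulantWords {D : ℕ} (hdeg : ∀ a : V,
      ENat.card (Quiver.Star a) ≤ (D : ℕ∞) ∧ ENat.card (Quiver.Costar a) ≤ (D : ℕ∞))
    (ω : CanonicalWeighting V) {n : ℕ} {w : Fin n → ShadowedEdge V} (hw : w ∈ cumulantWords ω n) :
    Even n := by
  obtain ⟨-, h1, e, he⟩ := (mem_cumulantWords_iff ω (fun a => (hdeg a).1) w).1 hw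
  obtain ⟨k, -, hk, hk2⟩ := exists_zpow_of_forall_eq_or_eq_inv ω e (List.ofFn w) (by
    intro g hg
    obtain ⟨j, rfl⟩ := (List.mem_ofFn' w g).1 hg
    exact he j)
  rw [List.map_ofFn, List.sum_ofFn] at hk
  have hk0 : k = 0 := by
    have h2 := hk.symm.trans h1
    exact (mul_eq_zero.1 h2).resolve_right (shadowLabel_ne_zero ω e)
  rw [hk0, List.length_ofFn] at hk2
  rw [even_iff_two_dvd]
  omega

end Convergence

end

theorem theorem5p11 {V : Type u} [Quiver.{v} V] (ω : CanonicalWeighting V)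
    (hdeg : ∃ D : ℕ, ∀ a : V,
      ENat.card (Quiver.Star a) ≤ (D : ℕ∞) ∧ ENat.card (Quiver.Costar a) ≤ (D : ℕ∞))
    (n : ℕ) (hn : 1 ≤ n) :
    (Odd n → freeCumulant condExpDiag (fun _ : Fin n => labelingOperator ω) = 0) ∧
    (Even n → ∀ ξ : GraphHilbert V,
      HasSum (fun w : cumulantWords ω n => muWord w.1 • (wordOperator w.1).1 ξ)
        ((freeCumulant condExpDiag (fun _ : Fin n => labelingOperator ω)).1.1 ξ)) := by
  obtain ⟨D, hdeg⟩ := hdeg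
  refine ⟨fun hodd => ?_, fun _ ξ => hasSum_freeCumulant_labelingOperator hdeg ω hn ξ⟩
  have : IsEmpty (cumulantWords ω n) :=
    ⟨fun w => (Nat.not_even_iff_odd.2 hodd) (even_of_mem_cumulantWords hdeg ω w.2)⟩
  refine Subtype.ext (Subtype.ext (ContinuousLinearMap.ext fun ξ => ?_))
  exact (hasSum_freeCumulant_labelingOperator hdeg ω hn ξ).unique hasSum_empty
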